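/- **Setting.** Let $d\in\{2,3\}$ and let $\Omega\subset\mathbb R^d$ be a bounded open set, partitioned into pairwise disjoint open subdomains $\Omega_1,\dots,\Omega_N\subset\Omega$ with $\overline\Omega=\bigcup_i\overline{\Omega_i}$. The interface $\Gamma=\bigcup_i\partial\Omega_i\setminus\partial\Omega$ is the union (off $\partial\Omega$) of pieces $\Gamma_m=\partial\Omega_{i_m}\cap\partial\Omega_{j_m}$, $m=1,\dots,M$, where $i_m\ne j_m$ and distinct $m$ have distinct pairs $\{i_m,j_m\}$. Let $\mu,\lambda$ be positive on every $\Omega_i$ and integrable over every $\Omega_i$ (for instance piecewise smooth up to the boundaries of the $\Omega_i$), and let $\mathbf f\in[L^2(\Omega_i)]^d$ for every $i$, $\mathbf g\in[L^2(\partial\Omega)]^d$, $\boldsymbol\phi_m,\boldsymbol\psi_m\in[L^2(\Gamma_m)]^d$. Let $\mathcal T_h$ be a finite partition of $\Omega$ into pairwise disjoint, possibly non-convex, polygonal ($d=2$) or polyhedral ($d=3$) domains $T$, each contained in some $\Omega_i$, such that the elements contained in $\Omega_i$ form a partition of $\Omega_i$, for every $i$. Let $\mathcal E_h$ be its finite set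 of edges/flat faces: they have pairwise disjoint connected relative interiors, $\partial T$ is the union of the faces $e\subset\partial T$, and $T$ has a constant unit outward normal $\mathbf n$ along each of them; a face contained in $\partial\Omega$ is a face of exactly one element, and every other face is a face of exactly two elements (hanging nodes count as vertices). Let $h_T$ be the diameter of $T$. **Spaces.** Let $k\ge1$ be an integer, $P_r$ the polynomials of total degree at most $r$, and $S_k(e)=[P_{k-1}(e)]^d+P_{RM}(e)$, where $P_{RM}(e)$ is the set of restrictions to $e$ of the rigid motions $\mathbf a+\eta\mathbf x$, $\mathbf a\in\mathbb R^d$, $\eta^T=-\eta$. The space $W_h$ consists of the families $\mathbf v=\{\mathbf v_0,\mathbf v_b\}$ with $\mathbf v_0|_T\in[P_k(T)]^d$ for each $T$ and, for each $T$ and each face $e\subset\partial T$, a value $\mathbf v_b|_{T,e}\in S_k(e)$, such that the two values of $\mathbf v_b$ on a face shared by two elements of the same subdomain coincide (on faces in $\Gamma$ they may differ). The subspace $W_h^0$ consists of those $\mathbf v\in W_h$ for which $\mathbf v_b=0$ on $\partial\Omega$ and $\mathbf v_b$ is single-valued on all faces, including those in $\Gamma$. **Discrete weak operators and forms.** On each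 $T$, $\nabla_w\cdot\mathbf v\in P_{k-1}(T)$ is the polynomial with $$(\nabla_w\cdot\mathbf v,w)_T=-(\mathbf v_0,\nabla w)_T+\langle\mathbf v_b,w\mathbf n\rangle_{\partial T}\qquad\forall w\in P_{k-1}(T),$$ and $\epsilon_w(\mathbf v)\in[P_{k-1}(T)]^{d\times d}$ is the symmetric polynomial matrix with $$(\epsilon_w(\mathbf v),\mathbf w)_T=-(\mathbf v_0,\nabla\cdot\mathbf w)_T+\langle\mathbf v_b,\mathbf w\mathbf n\rangle_{\partial T}\qquad\forall\,\mathbf w\in[P_{k-1}(T)]^{d\times d}\text{ symmetric},$$ where $(\nabla\cdot\mathbf w)_i=\sum_j\partial_j w_{ij}$. With $\mathbf Q_b$ the $L^2(e)$-projection onto $S_k(e)$ on each face $e$, put $$s(\mathbf u,\mathbf v)=\sum_{T}h_T^{-1}\langle\mathbf Q_b\mathbf u_0-\mathbf u_b,\mathbf Q_b\mathbf v_0-\mathbf v_b\rangle_{\partial T},$$ $$a(\mathbf u,\mathbf v)=\sum_{T}\big[(2\mu\,\epsilon_w(\mathbf u),\epsilon_w(\mathbf v))_T+(\lambda\nabla_w\cdot\mathbf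 u,\nabla_w\cdot\mathbf v)_T\big].$$ **Theorem.** There is exactly one $\mathbf u=\{\mathbf u_0,\mathbf u_b\}\in W_h$ such that $\mathbf u_b=\mathbf Q_b\mathbf g$ on every face in $\partial\Omega$; $\mathbf u_b^L-\mathbf u_b^R=\mathbf Q_b\boldsymbol\phi_m$ on every face in $\Gamma_m$ that is shared by an element of $\Omega_{i_m}$ and an element of $\Omega_{j_m}$, $m=1,\dots,M$, where $\mathbf u_b^L,\mathbf u_b^R$ are the values of $\mathbf u_b$ seen from $\Omega_{i_m}$ and $\Omega_{j_m}$ respectively; and $$s(\mathbf u,\mathbf v)+a(\mathbf u,\mathbf v)=(\mathbf f,\mathbf v_0)+\sum_{m=1}^M\langle\boldsymbol\psi_m,\mathbf v_b\rangle_{\Gamma_m}\qquad\forall\,\mathbf v\in W_h^0.$$ -/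

import Mathlib

open MeasureTheory Set

noncomputable section

namespace WG

/-- Points of (and vectors in) `d`-dimensional Euclidean space. -/
abbrev Pt (d : ℕ) := EuclideanSpace ℝ (Fin d)

/-! ### Polyhedral geometry -/

/-- A compact polyhedron: a finite union of convex polytopes (convex hulls of finite sets).
It need not be convex. -/
def IsCompactPolyhedron {d : ℕ} (s : Set (Pt d)) : Prop :=
  ∃ P : Finset (Finset (Pt d)), s = ⋃ p ∈ P, convexHull ℝ (p : Set (Pt d))

/-- A polygonal (`d = 2`) or polyhedral (`d = 3`) domain. -/
structure IsPolyhedralDomain {d : ℕ} (T : Set (Pt d)) : Prop where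
  isOpen : IsOpen T
  isConnected : IsConnected T
  closure_polyhedron : IsCompactPolyhedron (closure T)

/-- A (closed) edge (`d = 2`) or flat face (`d = 3`): a `(d-1)`-dimensional compact polyhedron
lying in a hyperplane, which is the closure of its connected relative interior. -/
structure IsFlatFace {d : ℕ} (e : Set (Pt d)) : Prop where
  polyhedron : IsCompactPolyhedron e
  codim_one : Module.finrank ℝ (vectorSpan ℝ e) + 1 = d
  closure_relint : closure (intrinsicInterior ℝ e) = e
  isConnected_relint : IsConnected (intrinsicInterior ℝ e)

/-- `n` is the unit outward normal of the open set `T` along the flat face `e ⊆ ∂T`. -/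
structure IsOutwardNormal {d : ℕ} (T e : Set (Pt d)) (n : Pt d) : Prop where
  norm_eq_one : ‖n‖ = 1
  orthogonal : ∀ v ∈ vectorSpan ℝ e, inner ℝ n v = 0
  outward : ∀ x ∈ intrinsicInterior ℝ e, ∃ δ > (0 : ℝ), ∀ t : ℝ, 0 < t → t < δ →
    x - t • n ∈ T ∧ x + t • n ∉ T

/-! ### The domain with its subdomains and interfaces -/

/-- A bounded open set `Ω`, partitioned into `N` open subdomains, whose interface
`(⋃ i, ∂Ω_i) \ ∂Ω` is made of the `M` pieces `Γ_m = ∂Ω_i ∩ ∂Ω_j` with `i = left m`,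
`j = right m`. The jump across `Γ_m` is the value from the `left m` side minus the value from
the `right m` side. -/
structure InterfaceGeometry (d N M : ℕ) where
  Ω : Set (Pt d)
  sub : Fin N → Set (Pt d)
  left : Fin M → Fin N
  right : Fin M → Fin N
  isOpen_Ω : IsOpen Ω
  isBounded_Ω : Bornology.IsBounded Ω
  isOpen_sub : ∀ i, IsOpen (sub i)
  sub_subset : ∀ i, sub i ⊆ Ω
  sub_disjoint : Pairwise fun i j => Disjoint (sub i) (sub j)
  closure_Ω : closure Ω = ⋃ i, closure (sub i)
  left_ne_right : ∀ m, left m ≠ right m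
  /-- different interface pieces belong to different (unordered) pairs of subdomains -/
  pair_injective : Function.Injective fun m => s(left m, right m)
  interface_eq : (⋃ i, frontier (sub i)) \ frontier Ω =
    (⋃ m, frontier (sub (left m)) ∩ frontier (sub (right m))) \ frontier Ω

/-- The interface piece `Γ_m`. -/
def InterfaceGeometry.Γ {d N M : ℕ} (G : InterfaceGeometry d N M) (m : Fin M) : Set (Pt d) :=
  frontier (G.sub (G.left m)) ∩ frontier (G.sub (G.right m))

/-! ### Polygonal / polyhedral partitions aligned with the interface -/

/-- A finite partition of `Ω` into polygonal/polyhedral elements `elem T` (`T : ι`), together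
with the finite family of its edges / flat faces `face e` (`e : κ`), aligned with the interface.
Hanging nodes are allowed: they are vertices at which a straight side of an element is split into
several edges. -/
structure PolyMesh {d N M : ℕ} (G : InterfaceGeometry d N M) (ι κ : Type*) where
  elem : ι → Set (Pt d)
  face : κ → Set (Pt d)
  /-- `normal T e` is the unit outward normal to `∂T` on the face `e` of `T`
  (its value is irrelevant when `e` is not a face of `T`) -/
  normal : ι → κ → Pt d
  elem_domain : ∀ T, IsPolyhedralDomain (elem T)
  elem_disjoint : Pairwise fun T T' => Disjoint (elem T) (elem T')
  /-- each element lies in one subdomain -/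
  elem_aligned : ∀ T, ∃ i, elem T ⊆ G.sub i
  /-- the elements lying in a subdomain form a partition of this subdomain -/
  closure_sub : ∀ i, closure (G.sub i) = ⋃ T ∈ {T | elem T ⊆ G.sub i}, closure (elem T)
  face_flat : ∀ e, IsFlatFace (face e)
  face_disjoint : Pairwise fun e e' =>
    Disjoint (intrinsicInterior ℝ (face e)) (intrinsicInterior ℝ (face e'))
  frontier_elem : ∀ T, frontier (elem T) = ⋃ e ∈ {e | face e ⊆ frontier (elem T)}, face e
  /-- a face on `∂Ω` is a face of exactly one element -/
  boundary_face : ∀ e, face e ⊆ frontier G.Ω → ∃! T, face e ⊆ frontier (elem T)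
  /-- every other face is shared by exactly two elements -/
  interior_face : ∀ e, ¬ face e ⊆ frontier G.Ω →
    ∃ T T', T ≠ T' ∧ ∀ S, face e ⊆ frontier (elem S) ↔ S = T ∨ S = T'
  normal_spec : ∀ T e, face e ⊆ frontier (elem T) →
    IsOutwardNormal (elem T) (face e) (normal T e)

/-! ### Polynomial spaces -/

/-- Value of the `d`-variate polynomial `p` at the point `x`. -/
def polyEval {d : ℕ} (p : MvPolynomial (Fin d) ℝ) (x : Pt d) : ℝ :=
  MvPolynomial.eval (fun i => x i) p

/-- The vector field with polynomial components `q i`. -/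
def polyVec {d : ℕ} (q : Fin d → MvPolynomial (Fin d) ℝ) (x : Pt d) : Pt d :=
  WithLp.toLp 2 fun i => polyEval (q i) x

/-- The rigid motion `x ↦ a + η x`. -/
def rigidMotion {d : ℕ} (a : Pt d) (η : Matrix (Fin d) (Fin d) ℝ) (x : Pt d) : Pt d :=
  WithLp.toLp 2 fun i => a i + ∑ j, η i j * x j

/-- The space `S_k(e) = [P_{k-1}(e)]^d + P_RM(e)` of functions on the face `e`. A function on `e`
is encoded as a function on the whole space that is zero outside of `e`. -/
def faceSpace {d : ℕ} (k : ℕ) (e : Set (Pt d)) : Set (Pt d → Pt d) :=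
  {v | ∃ (q : Fin d → MvPolynomial (Fin d) ℝ) (a : Pt d) (η : Matrix (Fin d) (Fin d) ℝ),
    (∀ i, (q i).totalDegree ≤ k - 1) ∧ η.transpose = -η ∧
    v = e.indicator fun x => polyVec q x + rigidMotion a η x}

/-- The surface (`(d-1)`-dimensional Lebesgue/Hausdorff) measure in `d`-dimensional space,
normalised so that it is length for `d = 2` and area for `d = 3`. -/
def surf (d : ℕ) : Measure (Pt d) := Measure.euclideanHausdorffMeasure (d - 1)

/-- `q` is the `L²` projection onto `S_k(e)` of the vector field `g` (given on `e`). -/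
def IsFaceProj {d : ℕ} (k : ℕ) (e : Set (Pt d)) (g q : Pt d → Pt d) : Prop :=
  q ∈ faceSpace k e ∧
    ∀ s ∈ faceSpace k e, ∫ x in e, inner ℝ (q x) (s x) ∂(surf d) =
      ∫ x in e, inner ℝ (g x) (s x) ∂(surf d)

/-- The `L²` projection `Q_b g` onto `S_k(e)`. -/
def faceProj {d : ℕ} (k : ℕ) (e : Set (Pt d)) (g : Pt d → Pt d) : Pt d → Pt d :=
  Classical.epsilon (IsFaceProj k e g)

/-! ### Weak functions and discrete weak operators -/

section Scheme

variable {d N M : ℕ} {G : InterfaceGeometry d N M} {ι κ : Type*} [Fintype ι] [Fintype κ]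

open Classical in
/-- The faces of the element `T`, i.e. the faces contained in `∂T`. -/
def PolyMesh.facesOf (𝒯 : PolyMesh G ι κ) (T : ι) : Finset κ :=
  {e | 𝒯.face e ⊆ frontier (𝒯.elem T)}

/-- A family `{v₀, v_b}`: on each element `T` a vector `v₀` of polynomials (a polynomial function on
the nonempty open set `T` is identified with the polynomial) and, on each face `e` of `T`, the
value `vb T e` of `v_b` on `e` as seen from `T`. -/
@[ext]
structure WeakFn (d : ℕ) (ι κ : Type*) where
  v0 : ι → Fin d → MvPolynomial (Fin d) ℝ
  vb : ι → κ → Pt d → Pt d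

/-- The polynomial `D` of degree at most `r` is the discrete weak divergence `∇_{w,r,T} · v` of
`v = {v₀, v_b}`: for all polynomials `w` of degree at most `r`,
`(D, w)_T = -(v₀, ∇w)_T + ⟨v_b, w n⟩_{∂T}`. -/
def IsWeakDiv (𝒯 : PolyMesh G ι κ) (r : ℕ) (T : ι) (v : WeakFn d ι κ)
    (D : MvPolynomial (Fin d) ℝ) : Prop :=
  D.totalDegree ≤ r ∧ ∀ w : MvPolynomial (Fin d) ℝ, w.totalDegree ≤ r →
    ∫ x in 𝒯.elem T, polyEval D x * polyEval w x =
      -(∫ x in 𝒯.elem T, ∑ i, polyEval (v.v0 T i) x * polyEval (MvPolynomial.pderiv i w) x)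
      + ∑ e ∈ 𝒯.facesOf T, ∫ x in 𝒯.face e,
          inner ℝ (v.vb T e x) (polyEval w x • 𝒯.normal T e) ∂(surf d)

/-- The discrete weak divergence. -/
def weakDiv (𝒯 : PolyMesh G ι κ) (r : ℕ) (T : ι) (v : WeakFn d ι κ) : MvPolynomial (Fin d) ℝ :=
  Classical.epsilon (IsWeakDiv 𝒯 r T v)

/-- The symmetric matrix `S` of polynomials of degree at most `r` is the discrete weak strain
`ε_{w,r,T}(v)` of `v = {v₀, v_b}`: for all symmetric matrices `w` of polynomials of degree at most
`r`, `(S, w)_T = -(v₀, ∇ · w)_T + ⟨v_b, w n⟩_{∂T}`, where `(∇ · w)_i = ∑ j, ∂_j w_{ij}`. -/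
def IsWeakStrain (𝒯 : PolyMesh G ι κ) (r : ℕ) (T : ι) (v : WeakFn d ι κ)
    (S : Matrix (Fin d) (Fin d) (MvPolynomial (Fin d) ℝ)) : Prop :=
  S.IsSymm ∧ (∀ i j, (S i j).totalDegree ≤ r) ∧
    ∀ w : Matrix (Fin d) (Fin d) (MvPolynomial (Fin d) ℝ), w.IsSymm →
      (∀ i j, (w i j).totalDegree ≤ r) →
      ∫ x in 𝒯.elem T, ∑ i, ∑ j, polyEval (S i j) x * polyEval (w i j) x =
        -(∫ x in 𝒯.elem T, ∑ i, polyEval (v.v0 T i) x *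
            ∑ j, polyEval (MvPolynomial.pderiv j (w i j)) x)
        + ∑ e ∈ 𝒯.facesOf T, ∫ x in 𝒯.face e,
            ∑ i, v.vb T e x i * ∑ j, polyEval (w i j) x * 𝒯.normal T e j ∂(surf d)

/-- The discrete weak strain. -/
def weakStrain (𝒯 : PolyMesh G ι κ) (r : ℕ) (T : ι) (v : WeakFn d ι κ) :
    Matrix (Fin d) (Fin d) (MvPolynomial (Fin d) ℝ) :=
  Classical.epsilon (IsWeakStrain 𝒯 r T v)

/-! ### The weak finite element spaces -/

/-- Membership in `W_h`: on each element `v₀ ∈ [P_k(T)]^d`, on each face `e` of `T` the boundary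
value lies in `S_k(e)`, and the two boundary values agree on every face shared by two elements of
the same subdomain (the interface faces are excluded). The meaningless values `vb T e`, for `e` not
a face of `T`, are set to zero. -/
structure MemW (𝒯 : PolyMesh G ι κ) (k : ℕ) (v : WeakFn d ι κ) : Prop where
  degree_le : ∀ T i, (v.v0 T i).totalDegree ≤ k
  mem_faceSpace : ∀ T, ∀ e ∈ 𝒯.facesOf T, v.vb T e ∈ faceSpace k (𝒯.face e)
  eq_zero : ∀ T, ∀ e ∉ 𝒯.facesOf T, v.vb T e = 0
  single_valued : ∀ e T T' i, e ∈ 𝒯.facesOf T → e ∈ 𝒯.facesOf T' →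
    𝒯.elem T ⊆ G.sub i → 𝒯.elem T' ⊆ G.sub i → v.vb T e = v.vb T' e

/-- Membership in the test space `W_h^0`: boundary values vanish on `∂Ω` and are single-valued on
all faces, those on the interface included. -/
structure MemW0 (𝒯 : PolyMesh G ι κ) (k : ℕ) (v : WeakFn d ι κ) : Prop where
  memW : MemW 𝒯 k v
  boundary : ∀ T, ∀ e ∈ 𝒯.facesOf T, 𝒯.face e ⊆ frontier G.Ω → v.vb T e = 0
  single_valued_all : ∀ e T T', e ∈ 𝒯.facesOf T → e ∈ 𝒯.facesOf T' → v.vb T e = v.vb T' e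

/-- `e` is a face on the interface piece `Γ_m`, shared by the element `T` on the left side and the
element `T'` on the right side of `Γ_m`. -/
def PolyMesh.IsInterfaceFace (𝒯 : PolyMesh G ι κ) (m : Fin M) (e : κ) (T T' : ι) : Prop :=
  𝒯.face e ⊆ G.Γ m ∧ e ∈ 𝒯.facesOf T ∧ e ∈ 𝒯.facesOf T' ∧
    𝒯.elem T ⊆ G.sub (G.left m) ∧ 𝒯.elem T' ⊆ G.sub (G.right m)

/-! ### Bilinear forms, data and the scheme -/

/-- `Q_b v₀ - v_b` on the face `e` of `T`. -/
def bdryDefect (𝒯 : PolyMesh G ι κ) (k : ℕ) (v : WeakFn d ι κ) (T : ι) (e : κ) (x : Pt d) : Pt d :=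
  faceProj k (𝒯.face e) (polyVec (v.v0 T)) x - v.vb T e x

/-- The stabilizer
`s(u, v) = ∑_T h_T⁻¹ ⟨Q_b u₀ - u_b, Q_b v₀ - v_b⟩_{∂T}`, `h_T` the diameter of `T`. -/
def stab (𝒯 : PolyMesh G ι κ) (k : ℕ) (u v : WeakFn d ι κ) : ℝ :=
  ∑ T, (Metric.diam (𝒯.elem T))⁻¹ * ∑ e ∈ 𝒯.facesOf T, ∫ x in 𝒯.face e,
    inner ℝ (bdryDefect 𝒯 k u T e x) (bdryDefect 𝒯 k v T e x) ∂(surf d)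

/-- `a(u, v) = ∑_T (2 μ ε_w(u), ε_w(v))_T + (λ ∇_w · u, ∇_w · v)_T`, where the discrete weak
operators are those of degree `k - 1`. -/
def elasticForm (𝒯 : PolyMesh G ι κ) (k : ℕ) (mu lam : Pt d → ℝ) (u v : WeakFn d ι κ) : ℝ :=
  ∑ T, ((∫ x in 𝒯.elem T, 2 * mu x * ∑ i, ∑ j,
      polyEval (weakStrain 𝒯 (k - 1) T u i j) x * polyEval (weakStrain 𝒯 (k - 1) T v i j) x)
    + ∫ x in 𝒯.elem T, lam x *
      (polyEval (weakDiv 𝒯 (k - 1) T u) x * polyEval (weakDiv 𝒯 (k - 1) T v) x))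

open Classical in
/-- The load functional `(f, v₀) + ∑_m ⟨ψ_m, v_b⟩_{Γ_m}`. For the second term the value of `v_b`
from the left side of `Γ_m` is used (for `v ∈ W_h^0` both sides give the same value). -/
def load (𝒯 : PolyMesh G ι κ) (f : Pt d → Pt d) (ψ : Fin M → Pt d → Pt d) (v : WeakFn d ι κ) : ℝ :=
  (∑ T, ∫ x in 𝒯.elem T, inner ℝ (f x) (polyVec (v.v0 T) x))
    + ∑ m, ∑ e, ∑ T, ∑ T', if 𝒯.IsInterfaceFace m e T T' then
        ∫ x in 𝒯.face e, inner ℝ (ψ m x) (v.vb T e x) ∂(surf d) else 0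

/-- `u` solves the weak Galerkin scheme with body force `f`, Dirichlet datum `g`, jump `φ_m` of the
displacement and jump `ψ_m` of the traction on `Γ_m`. -/
structure IsSolution (𝒯 : PolyMesh G ι κ) (k : ℕ) (mu lam : Pt d → ℝ) (f g : Pt d → Pt d)
    (φ ψ : Fin M → Pt d → Pt d) (u : WeakFn d ι κ) : Prop where
  memW : MemW 𝒯 k u
  boundary : ∀ T, ∀ e ∈ 𝒯.facesOf T, 𝒯.face e ⊆ frontier G.Ω →
    u.vb T e = faceProj k (𝒯.face e) g
  jump : ∀ m e T T', 𝒯.IsInterfaceFace m e T T' →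
    u.vb T e - u.vb T' e = faceProj k (𝒯.face e) (φ m)
  equation : ∀ v, MemW0 𝒯 k v →
    stab 𝒯 k u v + elasticForm 𝒯 k mu lam u v = load 𝒯 f ψ v

end Scheme

end WG

end

/-! ### Surface measure on hyperplanes and flat faces. -/

noncomputable section
namespace WG

variable {d : ℕ}

/-! ### Hyperplanes and slanted coordinates -/

/-! Subtracting a fixed element of `W_h` that carries the boundary and jump data (`PolyMesh.lift`)
leaves a problem in which trial and test functions both range over the finite-dimensional space
`W_h^0`. There, existence and uniqueness follow together from definiteness of `s + a`: an injective
linear map into the dual is onto (`IsBilinOn.exists_of_definite`). That two admissible functions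
differ by an element of `W_h^0` rests on `PolyMesh.exists_isInterfaceFace`: jumps are prescribed on
every face between different subdomains.

Definiteness is `MemW0.eq_zero`. If `s(v,v) + a(v,v) = 0`, every nonnegative contribution vanishes.
The stabilizer gives `v_b = Q_b v_0`. The vanishing weak strain is tested with `w`, twice the
classical strain of `v_0`. On a face `w n` lies in `[P_{k-1}]^d`, hence in `S_k`, so `Q_b`
disappears from the boundary term and integration by parts gives `w = 0` (`MemW.symmGrad_eq_zero`).
Thus `v_0` is a rigid motion on each element (`exists_rigidMotion`). Since `S_k` contains the rigid
motions, `v_b` is its exact trace, and a rigid motion that vanishes on a face vanishes everywhere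
(`IsFlatFace.rigidMotion_eq_zero`). Zero therefore spreads from `∂Ω` across faces.

The spreading needs no paths of elements. The elements with `v_0 ≠ 0` form a set without boundary
faces that is closed under passing to neighbours. Summing the divergence theorem for the field `x_j
e_j` over this set, each face occurs twice with opposite normals, so the total volume is zero
(`PolyMesh.eq_empty_of_closed`).

The divergence theorem on non-convex elements is `HasFlatBoundary.setIntegral_fderiv`. For a
direction `v` and almost every `x`, the indicator of `T` at `x` is the number of exits minus the
number of entries of the ray from `x` along `v` (`HasFlatBoundary.indicator_eq_sum_crossing`).
Integrated against the `v`-derivative of `f`, the crossings with one face give the flux through that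
face, by the fundamental theorem of calculus in slanted coordinates.

Projections and weak operators are choices made by `Classical.epsilon`, and integrals are additive
only on integrable functions. Linearity is therefore tracked on subspaces (`IsLinearOn`,
`IsBilinOn`), and for the chosen operators it follows from uniqueness of representatives
(`IsBilinOn.linear_of_represents`). -/

theorem measurePreserving_slantedChart {n v : Pt d} (x₀ : Pt d) (hn : ‖n‖ = 1)
    (hc : inner ℝ n v ≠ 0) :
    MeasurePreserving (fun p : ℝ × (ℝ ∙ n)ᗮ => x₀ + p.2 + p.1 • v)
      ((ENNReal.ofReal |inner ℝ n v| • (volume : Measure ℝ)).prod volume) volume := by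
  set c : ℝ := inner ℝ n v with hcdef
  have hw : v - c • n ∈ (ℝ ∙ n)ᗮ := by
    rw [Submodule.mem_orthogonal_singleton_iff_inner_right, inner_sub_right, inner_smul_right,
      real_inner_self_eq_norm_sq, hn]
    simp [hcdef]
  have h1 : MeasurePreserving (fun s : ℝ => c * s)
      (ENNReal.ofReal |c| • (volume : Measure ℝ)) volume := by
    refine ⟨by fun_prop, ?_⟩
    rw [Measure.map_smul, Real.smul_map_volume_mul_left hc]
  -- With `v = c n + w` and `w ⟂ n`, the chart is the shear `(s, z) ↦ (c s, z + s w)` followed by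
  -- the orthogonal splitting along `n`. Translations in the fibres preserve volume, so only the
  -- factor `|c|` remains.
  have h2 : MeasurePreserving
      (fun p : ℝ × (ℝ ∙ n)ᗮ => (c * p.1, p.2 + p.1 • (⟨v - c • n, hw⟩ : (ℝ ∙ n)ᗮ)))
      ((ENNReal.ofReal |c| • (volume : Measure ℝ)).prod volume) (volume.prod volume) := by
    refine h1.skew_product (g := fun s z => z + s • (⟨v - c • n, hw⟩ : (ℝ ∙ n)ᗮ)) (by fun_prop) ?_
    exact Filter.Eventually.of_forall fun s => (measurePreserving_add_right volume _).map_eq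
  have h3 : MeasurePreserving
      (Prod.map (LinearIsometryEquiv.toSpanUnitSingleton (𝕜 := ℝ) n hn) (id : (ℝ ∙ n)ᗮ → (ℝ ∙ n)ᗮ))
      (volume.prod volume) (volume.prod volume) :=
    (LinearIsometryEquiv.measurePreserving _).prod (MeasurePreserving.id _)
  have h4 := ((ℝ ∙ n).measurePreserving_measurableEquivProd x₀).symm
  rw [InnerProductSpace.euclideanHausdorffMeasure_eq_volume] at h4
  have h5 := (h4.comp h3).comp h2
  have heq : (fun p : ℝ × (ℝ ∙ n)ᗮ => x₀ + (p.2 : Pt d) + p.1 • v) =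
      (((ℝ ∙ n).measurableEquivProd x₀).symm ∘
        Prod.map (LinearIsometryEquiv.toSpanUnitSingleton (𝕜 := ℝ) n hn) id) ∘
      fun p : ℝ × (ℝ ∙ n)ᗮ => (c * p.1, p.2 + p.1 • (⟨v - c • n, hw⟩ : (ℝ ∙ n)ᗮ)) := by
    funext p
    simp only [Function.comp_apply, Prod.map, Submodule.measurableEquivProd_symm_apply, id,
      LinearIsometryEquiv.toSpanUnitSingleton_apply, Submodule.coe_add, Submodule.coe_smul,
      vadd_eq_add]
    module
  rw [heq]
  exact h5

theorem finrank_orthogonal_unit {n : Pt d} (hn : ‖n‖ = 1) :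
    Module.finrank ℝ (ℝ ∙ n)ᗮ = d - 1 := by
  have h := (ℝ ∙ n).finrank_add_finrank_orthogonal
  rw [finrank_span_singleton (by intro h; simp [h] at hn), finrank_euclideanSpace_fin] at h
  omega

theorem isometry_add_coe (n x₀ : Pt d) : Isometry fun z : (ℝ ∙ n)ᗮ => x₀ + (z : Pt d) :=
  (isometry_add_left x₀).comp isometry_subtype_coe

/-- Hausdorff measure is carried along by isometric embeddings and, with this normalisation, is
Lebesgue measure on the `(d-1)`-dimensional space orthogonal to `n`. Surface integrals thereby
become ordinary integrals. -/
theorem map_add_coe_volume {n : Pt d} (x₀ : Pt d) (hn : ‖n‖ = 1) :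
    (volume : Measure (ℝ ∙ n)ᗮ).map (fun z : (ℝ ∙ n)ᗮ => x₀ + (z : Pt d)) =
      (surf d).restrict (range fun z : (ℝ ∙ n)ᗮ => x₀ + (z : Pt d)) := by
  rw [← InnerProductSpace.euclideanHausdorffMeasure_eq_volume (V := (ℝ ∙ n)ᗮ),
    (isometry_add_coe n x₀).map_euclideanHausdorffMeasure, finrank_orthogonal_unit hn]
  rfl

theorem setIntegral_surf_eq {n : Pt d} (x₀ : Pt d) (hn : ‖n‖ = 1) {e : Set (Pt d)}
    (he : MeasurableSet e) (heH : e ⊆ range fun z : (ℝ ∙ n)ᗮ => x₀ + (z : Pt d)) (f : Pt d → ℝ) :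
    ∫ x in e, f x ∂(surf d) =
      ∫ z in (fun z : (ℝ ∙ n)ᗮ => x₀ + (z : Pt d)) ⁻¹' e, f (x₀ + z) := by
  have hemb : MeasurableEmbedding fun z : (ℝ ∙ n)ᗮ => x₀ + (z : Pt d) :=
    (isometry_add_coe n x₀).isClosedEmbedding.measurableEmbedding
  rw [← hemb.setIntegral_map, map_add_coe_volume x₀ hn, Measure.restrict_restrict he,
    inter_eq_left.2 heH]

theorem surf_eq_volume_preimage {n : Pt d} (x₀ : Pt d) (hn : ‖n‖ = 1) {e : Set (Pt d)}
    (he : MeasurableSet e) (heH : e ⊆ range fun z : (ℝ ∙ n)ᗮ => x₀ + (z : Pt d)) :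
    surf d e = volume ((fun z : (ℝ ∙ n)ᗮ => x₀ + (z : Pt d)) ⁻¹' e) := by
  have hemb : MeasurableEmbedding fun z : (ℝ ∙ n)ᗮ => x₀ + (z : Pt d) :=
    (isometry_add_coe n x₀).isClosedEmbedding.measurableEmbedding
  rw [← hemb.map_apply, map_add_coe_volume x₀ hn, Measure.restrict_apply he,
    inter_eq_left.2 heH]

/-! ### Flat faces -/

/-- `n` is a unit normal of the hyperplane that contains `e`. -/
structure IsUnitNormal (e : Set (Pt d)) (n : Pt d) : Prop where
  norm_eq_one : ‖n‖ = 1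
  orthogonal : ∀ v ∈ vectorSpan ℝ e, inner ℝ n v = 0

theorem IsOutwardNormal.isUnitNormal {T e : Set (Pt d)} {n : Pt d} (h : IsOutwardNormal T e n) :
    IsUnitNormal e n := ⟨h.1, h.2⟩

theorem IsCompactPolyhedron.isCompact {e : Set (Pt d)} (h : IsCompactPolyhedron e) :
    IsCompact e := by
  obtain ⟨P, rfl⟩ := h
  exact P.isCompact_biUnion fun p _ => p.finite_toSet.isCompact_convexHull ℝ

theorem IsFlatFace.isCompact {e : Set (Pt d)} (h : IsFlatFace e) : IsCompact e :=
  h.polyhedron.isCompact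

theorem IsFlatFace.relint_nonempty {e : Set (Pt d)} (h : IsFlatFace e) :
    (intrinsicInterior ℝ e).Nonempty := h.isConnected_relint.nonempty

theorem IsFlatFace.nonempty {e : Set (Pt d)} (h : IsFlatFace e) : e.Nonempty :=
  h.relint_nonempty.mono intrinsicInterior_subset

theorem IsFlatFace.vectorSpan_eq {e : Set (Pt d)} (h : IsFlatFace e) {n : Pt d}
    (hn : IsUnitNormal e n) : vectorSpan ℝ e = (ℝ ∙ n)ᗮ := by
  apply Submodule.eq_of_le_of_finrank_eq
  · intro v hv
    exact Submodule.mem_orthogonal_singleton_iff_inner_right.2 (hn.2 v hv)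
  · rw [finrank_orthogonal_unit hn.1]
    have := h.codim_one
    omega

theorem IsFlatFace.mem_affineSpan_iff {e : Set (Pt d)} (h : IsFlatFace e) {n : Pt d}
    (hn : IsUnitNormal e n) {x₀ : Pt d} (hx₀ : x₀ ∈ e) (y : Pt d) :
    y ∈ affineSpan ℝ e ↔ inner ℝ n (y - x₀) = 0 := by
  rw [← AffineSubspace.vsub_right_mem_direction_iff_mem (mem_affineSpan ℝ hx₀),
    direction_affineSpan, h.vectorSpan_eq hn, Submodule.mem_orthogonal_singleton_iff_inner_right]
  rfl

theorem IsFlatFace.inner_sub_eq_zero {e : Set (Pt d)} (h : IsFlatFace e) {n : Pt d}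
    (hn : IsUnitNormal e n) {x y : Pt d} (hx : x ∈ e) (hy : y ∈ e) : inner ℝ n (y - x) = 0 :=
  (h.mem_affineSpan_iff hn hx y).1 (mem_affineSpan ℝ hy)

theorem IsFlatFace.subset_range {e : Set (Pt d)} (h : IsFlatFace e) {n : Pt d}
    (hn : IsUnitNormal e n) {x₀ : Pt d} (hx₀ : x₀ ∈ e) :
    e ⊆ range fun z : (ℝ ∙ n)ᗮ => x₀ + (z : Pt d) := fun y hy =>
  ⟨⟨y - x₀, Submodule.mem_orthogonal_singleton_iff_inner_right.2 (h.inner_sub_eq_zero hn hx₀ hy)⟩,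
    by simp⟩

/-- The map `z ↦ x₀ + z` is a homeomorphism from the orthogonal complement of `n` onto the affine
span of the face, so the relative interior is the topological interior in these coordinates. -/
theorem IsFlatFace.mem_relint_iff {e : Set (Pt d)} (h : IsFlatFace e) {n : Pt d}
    (hn : IsUnitNormal e n) {x₀ : Pt d} (hx₀ : x₀ ∈ e) (z : (ℝ ∙ n)ᗮ) :
    x₀ + (z : Pt d) ∈ intrinsicInterior ℝ e ↔
      z ∈ interior ((fun z : (ℝ ∙ n)ᗮ => x₀ + (z : Pt d)) ⁻¹' e) := by
  let F : (ℝ ∙ n)ᗮ ≃ₜ affineSpan ℝ e :=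
    { toFun := fun z => ⟨x₀ + z, (h.mem_affineSpan_iff hn hx₀ _).2 (by
        simpa using Submodule.mem_orthogonal_singleton_iff_inner_right.1 z.2)⟩
      invFun := fun a => ⟨a - x₀, Submodule.mem_orthogonal_singleton_iff_inner_right.2
        ((h.mem_affineSpan_iff hn hx₀ _).1 a.2)⟩
      left_inv := fun z => by ext1; simp
      right_inv := fun a => by ext1; simp
      continuous_toFun := by fun_prop
      continuous_invFun := by fun_prop }
  have : (fun z : (ℝ ∙ n)ᗮ => x₀ + (z : Pt d)) ⁻¹' e =
      F ⁻¹' ((↑) ⁻¹' e : Set (affineSpan ℝ e)) := rfl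
  rw [this, ← F.preimage_interior, mem_intrinsicInterior]
  constructor
  · rintro ⟨y, hy, hyz⟩
    have : y = F z := Subtype.ext hyz
    rw [mem_preimage, ← this]
    exact hy
  · intro hz
    exact ⟨F z, hz, rfl⟩

theorem frontier_biUnion_subset {X ι : Type*} [TopologicalSpace X] (s : Finset ι)
    (f : ι → Set X) : frontier (⋃ i ∈ s, f i) ⊆ ⋃ i ∈ s, frontier (f i) := by
  classical
  induction s using Finset.induction_on with
  | empty => simp
  | insert a s ha ih =>
    simp only [Finset.set_biUnion_insert]
    refine (frontier_union_subset _ _).trans (union_subset_union inter_subset_left ?_)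
    exact inter_subset_right.trans ih

theorem IsFlatFace.measurableSet_relint {e : Set (Pt d)} (h : IsFlatFace e) {n : Pt d}
    (hn : IsUnitNormal e n) : MeasurableSet (intrinsicInterior ℝ e) := by
  obtain ⟨x₀, hx₀⟩ := h.nonempty
  have hemb : MeasurableEmbedding fun z : (ℝ ∙ n)ᗮ => x₀ + (z : Pt d) :=
    (isometry_add_coe n x₀).isClosedEmbedding.measurableEmbedding
  have : intrinsicInterior ℝ e = (fun z : (ℝ ∙ n)ᗮ => x₀ + (z : Pt d)) ''
      interior ((fun z : (ℝ ∙ n)ᗮ => x₀ + (z : Pt d)) ⁻¹' e) := by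
    ext y
    constructor
    · intro hy
      obtain ⟨z, rfl⟩ := h.subset_range hn hx₀ (intrinsicInterior_subset hy)
      exact ⟨z, (h.mem_relint_iff hn hx₀ z).1 hy, rfl⟩
    · rintro ⟨z, hz, rfl⟩
      exact (h.mem_relint_iff hn hx₀ z).2 hz
  rw [this]
  exact hemb.measurableSet_image.2 isOpen_interior.measurableSet

/-- The relative boundary of a flat face has zero surface measure. -/
theorem IsFlatFace.volume_preimage_relBdry {e : Set (Pt d)} (h : IsFlatFace e) {n : Pt d}
    (hn : IsUnitNormal e n) {x₀ : Pt d} (hx₀ : x₀ ∈ e) :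
    volume ((fun z : (ℝ ∙ n)ᗮ => x₀ + (z : Pt d)) ⁻¹' (e \ intrinsicInterior ℝ e)) = 0 := by
  obtain ⟨P, hP⟩ := h.polyhedron
  -- The relative boundary lies in the frontier of a finite union of convex slices, hence in the
  -- union of their frontiers; the frontier of a convex set is null.
  have hsub : (fun z : (ℝ ∙ n)ᗮ => x₀ + (z : Pt d)) ⁻¹' (e \ intrinsicInterior ℝ e) ⊆
      ⋃ p ∈ P, frontier ((fun z : (ℝ ∙ n)ᗮ => x₀ + (z : Pt d)) ⁻¹'
        convexHull ℝ (p : Set (Pt d))) := by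
    refine Subset.trans ?_ (frontier_biUnion_subset P _)
    intro z hz
    rw [← preimage_iUnion₂, ← hP]
    exact ⟨subset_closure hz.1, fun hi => hz.2 ((h.mem_relint_iff hn hx₀ z).2 hi)⟩
  refine measure_mono_null hsub ((measure_biUnion_null_iff P.countable_toSet).2 fun p _ => ?_)
  refine Convex.addHaar_frontier volume ?_
  exact ((convex_convexHull ℝ (p : Set (Pt d))).translate_preimage_right x₀).linear_preimage
    (ℝ ∙ n)ᗮ.subtype

theorem IsFlatFace.surf_relBdry {e : Set (Pt d)} (h : IsFlatFace e) {n : Pt d}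
    (hn : IsUnitNormal e n) : surf d (e \ intrinsicInterior ℝ e) = 0 := by
  obtain ⟨x₀, hx₀⟩ := h.nonempty
  rw [surf_eq_volume_preimage x₀ hn.1
    (h.isCompact.measurableSet.diff (h.measurableSet_relint hn))
    (sdiff_subset.trans (h.subset_range hn hx₀)), h.volume_preimage_relBdry hn hx₀]

theorem IsFlatFace.surf_lt_top {e : Set (Pt d)} (h : IsFlatFace e) {n : Pt d}
    (hn : IsUnitNormal e n) : surf d e < ⊤ := by
  obtain ⟨x₀, hx₀⟩ := h.nonempty
  rw [surf_eq_volume_preimage x₀ hn.1 h.isCompact.measurableSet (h.subset_range hn hx₀)]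
  exact ((isometry_add_coe n x₀).isClosedEmbedding.isCompact_preimage h.isCompact).measure_lt_top

/-- Nonempty relatively open subsets of a flat face have positive surface measure. -/
theorem IsFlatFace.surf_inter_pos {e : Set (Pt d)} (h : IsFlatFace e) {n : Pt d}
    (hn : IsUnitNormal e n) {U : Set (Pt d)} (hU : IsOpen U) (hne : (e ∩ U).Nonempty) :
    0 < surf d (e ∩ U) := by
  obtain ⟨y, hye, hyU⟩ := hne
  -- Density of the relative interior allows the point to be moved to one with a full
  -- `(d-1)`-dimensional neighbourhood inside `e`.
  rw [← h.closure_relint] at hye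
  obtain ⟨x, hxU, hx⟩ := mem_closure_iff.1 hye U hU hyU
  have hx₀ := intrinsicInterior_subset hx
  rw [surf_eq_volume_preimage x hn.1 (h.isCompact.measurableSet.inter hU.measurableSet)
    (inter_subset_left.trans (h.subset_range hn hx₀))]
  refine lt_of_lt_of_le ?_ (measure_mono (s := interior ((fun z : (ℝ ∙ n)ᗮ => x + (z : Pt d)) ⁻¹' e)
    ∩ (fun z : (ℝ ∙ n)ᗮ => x + (z : Pt d)) ⁻¹' U) ?_)
  · refine IsOpen.measure_pos _ (isOpen_interior.inter (hU.preimage (by fun_prop))) ⟨0, ?_, ?_⟩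
    · exact (h.mem_relint_iff hn hx₀ 0).1 (by simpa using hx)
    · simpa using hxU
  · exact inter_subset_inter_left _ interior_subset

end WG
end

/-! ### The divergence theorem via signed ray crossings. -/

noncomputable section
namespace WG

variable {d : ℕ}

/-! ### Counting signed crossings of rays with faces -/

/-- The parameter `s` such that `x - s • v` lies in the hyperplane through `x₀` with normal `n`. -/
def hypParam (n v x₀ x : Pt d) : ℝ := inner ℝ n (x - x₀) / inner ℝ n v

open Classical in
/-- The sign of the crossing of the open ray `{x + t • v | 0 < t}` with `e` (zero if there is no
crossing); the point `x` itself counts when the crossing is negative. -/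
def crossing (e : Set (Pt d)) (n v x₀ x : Pt d) : ℝ :=
  if x - hypParam n v x₀ x • v ∈ e then
    if 0 < inner ℝ n v then (if hypParam n v x₀ x < 0 then 1 else 0)
    else (if hypParam n v x₀ x ≤ 0 then -1 else 0)
  else 0

theorem continuous_hypParam (n v x₀ : Pt d) : Continuous (hypParam n v x₀) := by
  unfold hypParam
  fun_prop

theorem hypParam_add_smul {n v : Pt d} (hc : inner ℝ n v ≠ 0) (x₀ x : Pt d) (s : ℝ) :
    hypParam n v x₀ (x + s • v) = hypParam n v x₀ x + s := by
  unfold hypParam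
  rw [add_sub_right_comm, inner_add_right, inner_smul_right]
  field_simp

theorem hypParam_chart {n v : Pt d} (hc : inner ℝ n v ≠ 0) (x₀ : Pt d) (z : (ℝ ∙ n)ᗮ) (s : ℝ) :
    hypParam n v x₀ (x₀ + z + s • v) = s := by
  rw [hypParam_add_smul hc]
  have : inner ℝ n (z : Pt d) = 0 := Submodule.mem_orthogonal_singleton_iff_inner_right.1 z.2
  simp [hypParam, this]

theorem hypParam_eq_zero {n v x₀ x : Pt d} (h : inner ℝ n (x - x₀) = 0) :
    hypParam n v x₀ x = 0 := by
  simp [hypParam, h]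

theorem measurable_crossing {e : Set (Pt d)} (he : MeasurableSet e) (n v x₀ : Pt d) :
    Measurable (crossing e n v x₀) := by
  have hs := (continuous_hypParam n v x₀).measurable
  unfold crossing
  refine Measurable.ite (measurableSet_preimage (by fun_prop) he) ?_ measurable_const
  split_ifs
  · exact Measurable.ite (measurableSet_lt hs measurable_const) measurable_const measurable_const
  · exact Measurable.ite (measurableSet_le hs measurable_const) measurable_const measurable_const

theorem abs_crossing_le (e : Set (Pt d)) (n v x₀ x : Pt d) : ‖crossing e n v x₀ x‖ ≤ 1 := by
  unfold crossing
  split_ifs <;> simp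

theorem integral_Iic_fderiv_line {f : Pt d → ℝ} (hf : ContDiff ℝ 1 f) (hs : HasCompactSupport f)
    {v : Pt d} (hv : v ≠ 0) (y : Pt d) :
    ∫ s in Iic (0 : ℝ), fderiv ℝ f (y + s • v) v = f y := by
  have hemb : Topology.IsClosedEmbedding fun s : ℝ => y + s • v :=
    (Homeomorph.addLeft y).isClosedEmbedding.comp (isClosedEmbedding_smul_left hv)
  have hg : ContDiff ℝ 1 fun s : ℝ => f (y + s • v) := hf.comp (by fun_prop)
  have hgs : HasCompactSupport fun s : ℝ => f (y + s • v) := hs.comp_isClosedEmbedding hemb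
  have hd : ∀ s : ℝ, deriv (fun s : ℝ => f (y + s • v)) s = fderiv ℝ f (y + s • v) v := by
    intro s
    have h1 : HasFDerivAt f (fderiv ℝ f (y + s • v)) (y + s • v) :=
      (hf.differentiable (by norm_num) _).hasFDerivAt
    have h2 : HasDerivAt (fun s : ℝ => y + s • v) v s := by
      simpa using ((hasDerivAt_id s).smul_const v).const_add y
    exact (h1.comp_hasDerivAt s h2).deriv
  have := hgs.integral_Iic_deriv_eq hg 0
  simp only [hd] at this
  simpa using this

theorem integrable_crossing_mul_fderiv {e : Set (Pt d)} (he : MeasurableSet e) (n v x₀ : Pt d)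
    {f : Pt d → ℝ} (hf : ContDiff ℝ 1 f) (hs : HasCompactSupport f) :
    Integrable fun x => crossing e n v x₀ x * fderiv ℝ f x v := by
  have hcont : Continuous fun x => fderiv ℝ f x v :=
    (hf.continuous_fderiv (by norm_num)).clm_apply continuous_const
  have hint : Integrable fun x => fderiv ℝ f x v :=
    hcont.integrable_of_hasCompactSupport (hs.fderiv_apply (𝕜 := ℝ) v)
  exact hint.bdd_mul (measurable_crossing he n v x₀).aestronglyMeasurable
    (Filter.Eventually.of_forall fun x => abs_crossing_le e n v x₀ x)

/-- In the coordinates `x₀ + z + s • v` the crossing function is the indicator of the face in `z`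
times `1` on `s < 0` (exit) or `-1` on `s ≤ 0` (entry). The integral over `s` is `± f` at the foot
point, and this sign turns the Jacobian `|⟨n, v⟩|` into `⟨n, v⟩`. -/
theorem integral_crossing_mul_fderiv {e : Set (Pt d)} (he : IsFlatFace e) {n v x₀ : Pt d}
    (hn : IsUnitNormal e n) (hx₀ : x₀ ∈ e) (hc : inner ℝ n v ≠ 0) {f : Pt d → ℝ}
    (hf : ContDiff ℝ 1 f) (hs : HasCompactSupport f) :
    ∫ x, crossing e n v x₀ x * fderiv ℝ f x v = inner ℝ n v * ∫ x in e, f x ∂(surf d) := by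
  have hmp := measurePreserving_slantedChart x₀ hn.1 hc
  have hem := he.isCompact.measurableSet
  have hv : v ≠ 0 := by rintro rfl; simp at hc
  have hint := integrable_crossing_mul_fderiv hem n v x₀ hf hs
  have hint' := hmp.integrable_comp_of_integrable hint
  have hae : AEStronglyMeasurable (fun x => crossing e n v x₀ x * fderiv ℝ f x v)
      (Measure.map (fun p : ℝ × (ℝ ∙ n)ᗮ => x₀ + p.2 + p.1 • v)
        ((ENNReal.ofReal |inner ℝ n v| • (volume : Measure ℝ)).prod volume)) := by
    rw [hmp.map_eq]; exact hint.aestronglyMeasurable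
  have hcr : ∀ (s : ℝ) (z : (ℝ ∙ n)ᗮ), crossing e n v x₀ (x₀ + z + s • v) =
      ((fun z : (ℝ ∙ n)ᗮ => x₀ + (z : Pt d)) ⁻¹' e).indicator (fun _ =>
        if 0 < inner ℝ n v then (Iio (0 : ℝ)).indicator 1 s
        else - (Iic (0 : ℝ)).indicator 1 s) z := by
    intro s z
    unfold crossing
    rw [hypParam_chart hc, add_sub_cancel_right]
    by_cases hz : x₀ + (z : Pt d) ∈ e
    · rw [indicator_of_mem (by exact hz), if_pos hz]
      split_ifs with h1 h2 h2
      · simp [h2]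
      · simp [not_lt.1 h2]
      · simp [h2]
      · simp [not_le.1 h2]
    · rw [indicator_of_notMem (by exact hz), if_neg hz]
  rw [← hmp.map_eq, integral_map hmp.aemeasurable hae]
  refine (integral_prod_symm _ hint').trans ?_
  simp only [Function.comp_apply]
  rw [
    setIntegral_surf_eq x₀ hn.1 hem (he.subset_range hn hx₀), ← integral_const_mul,
    ← integral_indicator (hem.preimage (by fun_prop))]
  congr 1
  funext z
  rw [integral_smul_measure, ENNReal.toReal_ofReal (abs_nonneg _)]
  simp only [hcr]
  by_cases hz : z ∈ (fun z : (ℝ ∙ n)ᗮ => x₀ + (z : Pt d)) ⁻¹' e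
  · simp only [indicator_of_mem hz]
    split_ifs with h1
    · have : ∀ s : ℝ, (Iio (0 : ℝ)).indicator 1 s * fderiv ℝ f (x₀ + z + s • v) v =
          (Iio (0 : ℝ)).indicator (fun s => fderiv ℝ f (x₀ + z + s • v) v) s := by
        intro s; by_cases h : s ∈ Iio (0 : ℝ) <;> simp [h]
      simp only [this]
      rw [integral_indicator measurableSet_Iio, ← integral_Iic_eq_integral_Iio,
        integral_Iic_fderiv_line hf hs hv, abs_of_pos h1, smul_eq_mul]
    · have : ∀ s : ℝ, -(Iic (0 : ℝ)).indicator 1 s * fderiv ℝ f (x₀ + z + s • v) v =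
          -(Iic (0 : ℝ)).indicator (fun s => fderiv ℝ f (x₀ + z + s • v) v) s := by
        intro s; by_cases h : s ∈ Iic (0 : ℝ) <;> simp [h]
      simp only [this]
      rw [integral_neg, integral_indicator measurableSet_Iic,
        integral_Iic_fderiv_line hf hs hv, abs_of_nonpos (not_lt.1 h1), smul_eq_mul]
      ring
  · simp [indicator_of_notMem hz]

/-! ### Bounded open sets with a piecewise flat boundary -/

/-- `T` is a bounded open set whose frontier is the union of the flat faces `face e`, `e ∈ E`, along
which `T` has the outward normals `normal e`. -/
structure HasFlatBoundary {κ : Type*} (T : Set (Pt d)) (E : Finset κ) (face : κ → Set (Pt d))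
    (normal : κ → Pt d) : Prop where
  isOpen : IsOpen T
  isBounded : Bornology.IsBounded T
  flat : ∀ e ∈ E, IsFlatFace (face e)
  disjoint : ∀ e ∈ E, ∀ e' ∈ E, e ≠ e' →
    Disjoint (intrinsicInterior ℝ (face e)) (intrinsicInterior ℝ (face e'))
  frontier_eq : frontier T = ⋃ e ∈ E, face e
  normal_spec : ∀ e ∈ E, IsOutwardNormal T (face e) (normal e)

variable {κ : Type*} {T : Set (Pt d)} {E : Finset κ} {face : κ → Set (Pt d)} {normal : κ → Pt d}

theorem _root_.IsPreconnected.exists_mem_frontier {X : Type*} [TopologicalSpace X] {t u : Set X}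
    (ht : IsPreconnected t) (h₁ : (t ∩ u).Nonempty) (h₂ : (t ∩ uᶜ).Nonempty) :
    (t ∩ frontier u).Nonempty := by
  by_contra hne
  have hfr : ∀ x ∈ t, x ∉ frontier u := fun x hx hx' => hne ⟨x, hx, hx'⟩
  obtain ⟨a, hat, hau⟩ := h₁
  obtain ⟨b, hbt, hbu⟩ := h₂
  obtain ⟨x, -, hx, hx'⟩ := ht (interior u) (closure u)ᶜ isOpen_interior
    isClosed_closure.isOpen_compl
    (fun x hx => by
      by_cases hxc : x ∈ closure u
      · exact Or.inl (by_contra fun hi => hfr x hx ⟨hxc, hi⟩)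
      · exact Or.inr hxc)
    ⟨a, hat, by_contra fun hi => hfr a hat ⟨subset_closure hau, hi⟩⟩
    ⟨b, hbt, fun hc => hfr b hbt ⟨hc, fun hi => hbu (interior_subset hi)⟩⟩
  exact hx' (interior_subset_closure hx)

/-- In a ball that misses all other faces, the frontier of `T` stays in the hyperplane of `e`. Each
open half ball is connected and misses the frontier, so it lies on one side of it; a point on the
normal through `y` shows which. -/
theorem HasFlatBoundary.exists_ball (h : HasFlatBoundary T E face normal) {e : κ} (he : e ∈ E)
    {y : Pt d} (hy : y ∈ intrinsicInterior ℝ (face e))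
    (hy' : ∀ e' ∈ E, e' ≠ e → y ∉ face e') :
    ∃ r > 0, ∀ x ∈ Metric.ball y r, (inner ℝ (normal e) (x - y) < 0 → x ∈ T) ∧
      (0 < inner ℝ (normal e) (x - y) → x ∉ T) := by
  classical
  have hcl : IsClosed (⋃ e' ∈ E.erase e, face e') :=
    (E.erase e).finite_toSet.isClosed_biUnion fun e' he' =>
      (h.flat e' (Finset.mem_of_mem_erase he')).isCompact.isClosed
  have hyc : y ∈ (⋃ e' ∈ E.erase e, face e')ᶜ := by
    simp only [mem_compl_iff, mem_iUnion, not_exists]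
    intro e' he'
    exact hy' e' (Finset.mem_of_mem_erase he') (Finset.ne_of_mem_erase he')
  obtain ⟨r, hr, hball⟩ := Metric.isOpen_iff.1 hcl.isOpen_compl y hyc
  have hN := h.normal_spec e he
  have hfr : ∀ x ∈ Metric.ball y r, x ∈ frontier T → inner ℝ (normal e) (x - y) = 0 := by
    intro x hx hxf
    rw [h.frontier_eq] at hxf
    obtain ⟨e', he', hxe'⟩ := mem_iUnion₂.1 hxf
    by_cases hee : e' = e
    · subst hee
      exact (h.flat _ he).inner_sub_eq_zero hN.isUnitNormal (intrinsicInterior_subset hy) hxe'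
    · exact absurd (mem_iUnion₂.2 ⟨e', Finset.mem_erase.2 ⟨hee, he'⟩, hxe'⟩) (hball hx)
  obtain ⟨δ, hδ, hout⟩ := hN.outward y hy
  obtain ⟨t, ht0, ht⟩ : ∃ t : ℝ, 0 < t ∧ t < min δ r := exists_between (lt_min hδ hr)
  have htδ := lt_of_lt_of_le ht (min_le_left _ _)
  have htr := lt_of_lt_of_le ht (min_le_right _ _)
  have hlin : IsLinearMap ℝ fun x : Pt d => inner ℝ (normal e) x :=
    ⟨fun a b => inner_add_right _ _ _, fun a b => inner_smul_right _ _ _⟩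
  have hsub : ∀ x : Pt d, inner ℝ (normal e) (x - y) = inner ℝ (normal e) x
      - inner ℝ (normal e) y := fun x => inner_sub_right _ _ _
  refine ⟨r, hr, fun x hx => ⟨fun hneg => ?_, fun hpos hxT => ?_⟩⟩
  · by_contra hxT
    have hconv : IsPreconnected (Metric.ball y r ∩
        {x | inner ℝ (normal e) x < inner ℝ (normal e) y}) :=
      ((convex_ball y r).inter (convex_halfSpace_lt hlin _)).isPreconnected
    obtain ⟨w, ⟨hw, hw'⟩, hwf⟩ := hconv.exists_mem_frontier (u := T)
      ⟨y - t • normal e, ⟨by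
        simpa [norm_smul, hN.norm_eq_one, abs_of_pos ht0] using htr, by
        simp [inner_sub_right, inner_smul_right, hN.norm_eq_one, ht0]⟩, (hout t ht0 htδ).1⟩
      ⟨x, ⟨hx, by
        have := hsub x
        simp only [mem_ofPred_eq]; linarith⟩, hxT⟩
    have := hfr w hw hwf
    rw [hsub] at this
    simp only [mem_ofPred_eq] at hw'
    linarith
  · have hconv : IsPreconnected (Metric.ball y r ∩
        {x | inner ℝ (normal e) y < inner ℝ (normal e) x}) :=
      ((convex_ball y r).inter (convex_halfSpace_gt hlin _)).isPreconnected
    obtain ⟨w, ⟨hw, hw'⟩, hwf⟩ := hconv.exists_mem_frontier (u := T)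
      ⟨x, ⟨hx, by
        have := hsub x
        simp only [mem_ofPred_eq]; linarith⟩, hxT⟩
      ⟨y + t • normal e, ⟨by
        simpa [norm_smul, hN.norm_eq_one, abs_of_pos ht0] using htr, by
        simp [inner_add_right, inner_smul_right, hN.norm_eq_one, ht0]⟩, (hout t ht0 htδ).2⟩
    have := hfr w hw hwf
    rw [hsub] at this
    simp only [mem_ofPred_eq] at hw'
    linarith

/-- Moving along `v` leaves the foot point in the hyperplane fixed, so the crossing number can
change only when the moving point reaches its foot and this foot lies in `e`. If `v` is parallel to
the hyperplane, division by zero makes `hypParam` zero and the crossing function vanishes off `e`.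
-/
theorem eventually_crossing_eq {e : Set (Pt d)} (he : IsClosed e) (n v x₀ x : Pt d) {s₀ : ℝ}
    (hs₀ : x + s₀ • v ∉ e) :
    ∀ᶠ s in nhds s₀, crossing e n v x₀ (x + s • v) = crossing e n v x₀ (x + s₀ • v) := by
  classical
  have hcont : Continuous fun s : ℝ => x + s • v := by fun_prop
  by_cases hc : inner ℝ n v = 0
  · have : ∀ y ∉ e, crossing e n v x₀ y = 0 := by
      intro y hy
      simp [crossing, hypParam, hc, hy]
    filter_upwards [hcont.continuousAt.eventually_mem (he.isOpen_compl.mem_nhds hs₀)] with s hs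
    rw [this _ hs, this _ hs₀]
  · have hp : ∀ s : ℝ, x + s • v - (hypParam n v x₀ x + s) • v = x - hypParam n v x₀ x • v := by
      intro s; module
    have hcr : ∀ s : ℝ, crossing e n v x₀ (x + s • v) =
        if x - hypParam n v x₀ x • v ∈ e then
          if 0 < inner ℝ n v then (if hypParam n v x₀ x + s < 0 then 1 else 0)
          else (if hypParam n v x₀ x + s ≤ 0 then -1 else 0)
        else 0 := by
      intro s
      unfold crossing
      rw [hypParam_add_smul hc, hp]
    simp only [hcr]
    by_cases hxe : x - hypParam n v x₀ x • v ∈ e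
    · have hne : hypParam n v x₀ x + s₀ ≠ 0 := by
        intro h0
        apply hs₀
        have h1 := hp s₀
        rw [h0, zero_smul, sub_zero] at h1
        rwa [h1]
      have hcs : Continuous fun s : ℝ => hypParam n v x₀ x + s := by fun_prop
      rcases lt_or_gt_of_ne hne with hlt | hgt
      · filter_upwards [hcs.continuousAt.eventually_lt continuousAt_const hlt] with s hs
        simp [hs, hlt, hs.le, hlt.le]
      · filter_upwards [continuousAt_const.eventually_lt hcs.continuousAt hgt] with s hs
        simp [hs.not_gt, hgt.not_gt, hs.not_ge, hgt.not_ge]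
    · simp [hxe]

/-- The difference of the two sides, moved along the line `x + s • v`, is locally constant: at a
face both sides jump by the same amount. It vanishes far along the ray, hence everywhere on the
connected line. -/
theorem HasFlatBoundary.indicator_eq_sum_crossing (h : HasFlatBoundary T E face normal)
    {b : κ → Pt d} (hb : ∀ e ∈ E, b e ∈ face e) {v : Pt d} (hv : v ≠ 0) {x : Pt d}
    (hx : ∀ s : ℝ, ∀ e ∈ E, x + s • v ∈ face e →
      x + s • v ∈ intrinsicInterior ℝ (face e) ∧ inner ℝ (normal e) v ≠ 0) :
    T.indicator 1 x = ∑ e ∈ E, crossing (face e) (normal e) v (b e) x := by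
  classical
  set D : ℝ → ℝ := fun s => T.indicator 1 (x + s • v) -
    ∑ e ∈ E, crossing (face e) (normal e) v (b e) (x + s • v) with hD
  have hcont : Continuous fun s : ℝ => x + s • v := by fun_prop
  have hcross : ∀ s₀ : ℝ, ∀ F ⊆ E, (∀ e ∈ F, x + s₀ • v ∉ face e) →
      ∀ᶠ s in nhds s₀, ∑ e ∈ F, crossing (face e) (normal e) v (b e) (x + s • v) =
        ∑ e ∈ F, crossing (face e) (normal e) v (b e) (x + s₀ • v) := by
    intro s₀ F hF hF'
    have : ∀ᶠ s in nhds s₀, ∀ e ∈ F, crossing (face e) (normal e) v (b e) (x + s • v) =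
        crossing (face e) (normal e) v (b e) (x + s₀ • v) :=
      (Filter.eventually_all_finset F).2 fun e he =>
        eventually_crossing_eq (h.flat e (hF he)).isCompact.isClosed _ _ _ _ (hF' e he)
    filter_upwards [this] with s hs
    exact Finset.sum_congr rfl hs
  have hloc : IsLocallyConstant D := by
    rw [IsLocallyConstant.iff_eventually_eq]
    intro s₀
    by_cases hfr : x + s₀ • v ∈ frontier T
    · have hfr' := hfr
      rw [h.frontier_eq] at hfr'
      obtain ⟨e, he, hye⟩ := mem_iUnion₂.1 hfr'
      obtain ⟨hyr, hc⟩ := hx s₀ e he hye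
      have hother : ∀ e' ∈ E, e' ≠ e → x + s₀ • v ∉ face e' := by
        intro e' he' hne hye'
        exact Set.disjoint_left.1 (h.disjoint e' he' e he hne) (hx s₀ e' he' hye').1 hyr
      obtain ⟨r, hr, hball⟩ := h.exists_ball he hyr hother
      have hyT : x + s₀ • v ∉ T := by
        intro hyT
        rw [h.isOpen.frontier_eq] at hfr
        exact hfr.2 hyT
      have hpar : ∀ s : ℝ, hypParam (normal e) v (b e) (x + s • v) = s - s₀ := by
        intro s
        have h0 : hypParam (normal e) v (b e) (x + s₀ • v) = 0 := hypParam_eq_zero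
          ((h.flat e he).inner_sub_eq_zero (h.normal_spec e he).isUnitNormal (hb e he) hye)
        rw [hypParam_add_smul hc] at h0 ⊢
        linarith
      have hcr : ∀ s : ℝ, crossing (face e) (normal e) v (b e) (x + s • v) =
          if 0 < inner ℝ (normal e) v then (if s - s₀ < 0 then 1 else 0)
          else (if s - s₀ ≤ 0 then -1 else 0) := by
        intro s
        unfold crossing
        rw [hpar, if_pos]
        convert hye using 1
        module
      have hside : ∀ s : ℝ, inner ℝ (normal e) (x + s • v - (x + s₀ • v)) =
          (s - s₀) * inner ℝ (normal e) v := by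
        intro s
        rw [show x + s • v - (x + s₀ • v) = (s - s₀) • v by module, inner_smul_right]
      have hev : ∀ᶠ s in nhds s₀, x + s • v ∈ Metric.ball (x + s₀ • v) r :=
        hcont.continuousAt.eventually_mem (Metric.ball_mem_nhds _ hr)
      filter_upwards [hev, hcross s₀ (E.erase e) (Finset.erase_subset _ _) fun e' he' =>
        hother e' (Finset.mem_of_mem_erase he') (Finset.ne_of_mem_erase he')] with s hs hsum
      simp only [hD]
      rw [← Finset.add_sum_erase _ _ he, ← Finset.add_sum_erase _ _ he, hsum, ← sub_sub, ← sub_sub]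
      congr 1
      -- Face points are outside the open set `T`. This is why exits are counted for `s < 0` and
      -- entries for `s ≤ 0`: with these conventions the jumps also match at `s = s₀`.
      rw [hcr, hcr, indicator_of_notMem hyT]
      obtain ⟨hb1, hb2⟩ := hball _ hs
      rw [hside] at hb1 hb2
      rcases lt_or_gt_of_ne hc with hneg | hpos
      · rw [if_neg hneg.not_gt, if_neg hneg.not_gt]
        rcases lt_trichotomy s s₀ with hlt | heq | hgt
        · rw [indicator_of_notMem (hb2 (mul_pos_of_neg_of_neg (by linarith) hneg)),
            if_pos (by linarith), if_pos (by linarith)]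
        · subst heq
          rw [indicator_of_notMem hyT]
        · rw [indicator_of_mem (hb1 (mul_neg_of_pos_of_neg (by linarith) hneg)),
            if_neg (by linarith), if_pos (by linarith)]
          simp
      · rw [if_pos hpos, if_pos hpos]
        rcases lt_trichotomy s s₀ with hlt | heq | hgt
        · rw [indicator_of_mem (hb1 (mul_neg_of_neg_of_pos (by linarith) hpos)),
            if_pos (by linarith), if_neg (by linarith)]
          simp
        · subst heq
          rw [indicator_of_notMem hyT]
        · rw [indicator_of_notMem (hb2 (mul_pos (by linarith) hpos)),
            if_neg (by linarith), if_neg (by linarith)]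
    · have hnot : ∀ e ∈ E, x + s₀ • v ∉ face e := by
        intro e he hye
        exact hfr (h.frontier_eq ▸ mem_iUnion₂.2 ⟨e, he, hye⟩)
      have hind : ∀ᶠ s in nhds s₀, T.indicator (1 : Pt d → ℝ) (x + s • v) =
          T.indicator 1 (x + s₀ • v) := by
        by_cases hT : x + s₀ • v ∈ T
        · filter_upwards [hcont.continuousAt.eventually_mem (h.isOpen.mem_nhds hT)] with s hs
          rw [indicator_of_mem hs, indicator_of_mem hT]; rfl
        · have hcl : x + s₀ • v ∉ closure T := by
            intro hcl
            exact hfr (by rw [h.isOpen.frontier_eq]; exact ⟨hcl, hT⟩)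
          filter_upwards [hcont.continuousAt.eventually_mem
            (isClosed_closure.isOpen_compl.mem_nhds hcl)] with s hs
          rw [indicator_of_notMem (fun h' => hs (subset_closure h')), indicator_of_notMem hT]
      filter_upwards [hind, hcross s₀ E subset_rfl hnot] with s hs hs'
      simp only [hD, hs, hs']
  -- Far out the point has left the bounded set `T`, and every face hyperplane transversal to `v`
  -- lies behind it.
  have hfar : ∃ s, D s = 0 := by
    have hT : ∀ᶠ s : ℝ in Filter.atTop, x + s • v ∉ T := by
      have htend : Filter.Tendsto (fun s : ℝ => x + s • v) Filter.atTop
          (Filter.cocompact (Pt d)) :=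
        (((Homeomorph.addLeft x).isClosedEmbedding.comp
          (isClosedEmbedding_smul_left hv)).tendsto_cocompact).mono_left
            (atTop_le_cocompact)
      have hTc : (closure T)ᶜ ∈ Filter.cocompact (Pt d) :=
        h.isBounded.isCompact_closure.compl_mem_cocompact
      filter_upwards [htend hTc] with s hs hsT
      exact hs (subset_closure hsT)
    have hE : ∀ᶠ s : ℝ in Filter.atTop, ∀ e ∈ E,
        crossing (face e) (normal e) v (b e) (x + s • v) = 0 := by
      refine (Filter.eventually_all_finset E).2 fun e he => ?_
      by_cases hc : inner ℝ (normal e) v = 0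
      · refine Filter.Eventually.of_forall fun s => ?_
        have : x + s • v ∉ face e := fun hm => (hx s e he hm).2 hc
        simp [crossing, hypParam, hc, this]
      · filter_upwards [Filter.eventually_gt_atTop (-hypParam (normal e) v (b e) x)] with s hs
        have hpos : 0 < hypParam (normal e) v (b e) x + s := by linarith
        simp [crossing, hypParam_add_smul hc, hpos.not_gt, hpos.not_ge]
    obtain ⟨s, hs, hs'⟩ := (hT.and hE).exists
    refine ⟨s, ?_⟩
    simp only [hD]
    rw [indicator_of_notMem hs, Finset.sum_eq_zero hs', sub_zero]
  obtain ⟨s, hs⟩ := hfar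
  have h0 : D 0 = 0 := (hloc.apply_eq_of_preconnectedSpace 0 s).trans hs
  simp only [hD, zero_smul, add_zero] at h0
  linarith

theorem IsFlatFace.volume_affineSpan {e : Set (Pt d)} (he : IsFlatFace e) :
    volume (affineSpan ℝ e : Set (Pt d)) = 0 := by
  apply Measure.addHaar_affineSubspace
  intro htop
  have h1 := he.codim_one
  rw [← direction_affineSpan, htop, AffineSubspace.direction_top, finrank_top,
    finrank_euclideanSpace_fin] at h1
  omega

/-- Almost every line in the direction `v` meets a face only transversally and in its relative
interior. -/
theorem IsFlatFace.ae_line {e : Set (Pt d)} (he : IsFlatFace e) {n : Pt d} (hn : IsUnitNormal e n)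
    (v : Pt d) : ∀ᵐ x : Pt d, ∀ s : ℝ, x + s • v ∈ e →
      x + s • v ∈ intrinsicInterior ℝ e ∧ inner ℝ n v ≠ 0 := by
  obtain ⟨x₀, hx₀⟩ := he.nonempty
  rw [ae_iff]
  -- A line parallel to the hyperplane that meets `e` is contained in the hyperplane, which is null.
  -- In the transversal case the exceptional points are those whose foot lies on the relative
  -- boundary; in slanted coordinates they form `ℝ` times a null set.
  by_cases hc : inner ℝ n v = 0
  · refine measure_mono_null ?_ he.volume_affineSpan
    intro x hx
    simp only [mem_ofPred_eq, not_forall] at hx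
    obtain ⟨s, hs, -⟩ := hx
    rw [SetLike.mem_coe, he.mem_affineSpan_iff hn hx₀]
    have := he.inner_sub_eq_zero hn hx₀ hs
    rwa [add_sub_right_comm, inner_add_right, inner_smul_right, hc, mul_zero, add_zero] at this
  · have hmp := measurePreserving_slantedChart x₀ hn.1 hc
    have hN : MeasurableSet (e \ intrinsicInterior ℝ e) :=
      he.isCompact.measurableSet.diff (he.measurableSet_relint hn)
    have hcont : Continuous fun x => x - hypParam n v x₀ x • v := by
      have := continuous_hypParam n v x₀
      fun_prop
    refine measure_mono_null (t := (fun x => x - hypParam n v x₀ x • v) ⁻¹'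
      (e \ intrinsicInterior ℝ e)) ?_ ?_
    · intro x hx
      simp only [mem_ofPred_eq, not_forall] at hx
      obtain ⟨s, hs, hs'⟩ := hx
      have h0 : hypParam n v x₀ (x + s • v) = 0 :=
        hypParam_eq_zero (he.inner_sub_eq_zero hn hx₀ hs)
      rw [hypParam_add_smul hc] at h0
      have h1 : x - hypParam n v x₀ x • v = x + s • v := by
        rw [show hypParam n v x₀ x = -s by linarith]; module
      rw [mem_preimage, h1]
      exact ⟨hs, fun h => hs' ⟨h, hc⟩⟩
    · rw [← hmp.measure_preimage (hN.preimage hcont.measurable).nullMeasurableSet]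
      have : (fun p : ℝ × (ℝ ∙ n)ᗮ => x₀ + (p.2 : Pt d) + p.1 • v) ⁻¹'
          ((fun x => x - hypParam n v x₀ x • v) ⁻¹' (e \ intrinsicInterior ℝ e)) =
          univ ×ˢ ((fun z : (ℝ ∙ n)ᗮ => x₀ + (z : Pt d)) ⁻¹' (e \ intrinsicInterior ℝ e)) := by
        ext ⟨s, z⟩
        simp [hypParam_chart hc]
      rw [this, Measure.prod_prod, he.volume_preimage_relBdry hn hx₀, mul_zero]

/-- The divergence theorem for compactly supported functions. -/
theorem HasFlatBoundary.setIntegral_fderiv_of_hasCompactSupport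
    (h : HasFlatBoundary T E face normal) (v : Pt d) {f : Pt d → ℝ} (hf : ContDiff ℝ 1 f)
    (hs : HasCompactSupport f) :
    ∫ x in T, fderiv ℝ f x v =
      ∑ e ∈ E, inner ℝ (normal e) v * ∫ x in face e, f x ∂(surf d) := by
  classical
  by_cases hv : v = 0
  · simp [hv]
  set b : κ → Pt d := fun e => if he : (face e).Nonempty then he.some else 0
  have hb : ∀ e ∈ E, b e ∈ face e := by
    intro e he
    simp only [b, dif_pos (h.flat e he).nonempty]
    exact (h.flat e he).nonempty.some_mem
  have hae : ∀ᵐ x : Pt d, ∀ e ∈ E, ∀ s : ℝ, x + s • v ∈ face e →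
      x + s • v ∈ intrinsicInterior ℝ (face e) ∧ inner ℝ (normal e) v ≠ 0 :=
    (Filter.eventually_all_finset E).2 fun e he =>
      (h.flat e he).ae_line (h.normal_spec e he).isUnitNormal v
  rw [← integral_indicator h.isOpen.measurableSet]
  have hcongr : ∀ᵐ x : Pt d, T.indicator (fun x => fderiv ℝ f x v) x =
      ∑ e ∈ E, crossing (face e) (normal e) v (b e) x * fderiv ℝ f x v := by
    filter_upwards [hae] with x hx
    rw [← Finset.sum_mul, ← h.indicator_eq_sum_crossing hb hv fun s e he => hx e he s]
    by_cases hxT : x ∈ T <;> simp [hxT]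
  rw [integral_congr_ae hcongr, integral_finsetSum E fun e he => integrable_crossing_mul_fderiv
    (h.flat e he).isCompact.measurableSet _ _ _ hf hs]
  refine Finset.sum_congr rfl fun e he => ?_
  -- A face parallel to `v` carries no flux, and its crossing function is supported on the face
  -- itself, which almost every `x` avoids.
  by_cases hc : inner ℝ (normal e) v = 0
  · rw [hc, zero_mul]
    refine integral_eq_zero_of_ae ?_
    filter_upwards [hae] with x hx
    have : x ∉ face e := by
      intro hm
      exact (hx e he 0 (by simpa using hm)).2 hc
    simp [crossing, hypParam, hc, this]
  · exact integral_crossing_mul_fderiv (h.flat e he) (h.normal_spec e he).isUnitNormal (hb e he)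
      hc hf hs

/-- The divergence theorem on a bounded open set with piecewise flat boundary. -/
theorem HasFlatBoundary.setIntegral_fderiv (h : HasFlatBoundary T E face normal) (v : Pt d)
    {f : Pt d → ℝ} (hf : ContDiff ℝ 1 f) :
    ∫ x in T, fderiv ℝ f x v =
      ∑ e ∈ E, inner ℝ (normal e) v * ∫ x in face e, f x ∂(surf d) := by
  obtain ⟨R, hR, hTR⟩ := h.isBounded.closure.subset_ball_lt 0 0
  -- The cutoff equals one near the closure of `T`, so neither side notices it.
  let χ : ContDiffBump (0 : Pt d) := ⟨R, R + 1, hR, by linarith⟩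
  have hχ : ∀ x ∈ Metric.ball (0 : Pt d) R, (fun x => χ x * f x) =ᶠ[nhds x] f := by
    intro x hx
    filter_upwards [Metric.isOpen_ball.mem_nhds hx] with y hy
    rw [χ.one_of_mem_closedBall (Metric.ball_subset_closedBall hy), one_mul]
  have hmain := h.setIntegral_fderiv_of_hasCompactSupport v (f := fun x => χ x * f x)
    (χ.contDiff.mul hf) χ.hasCompactSupport.mul_right
  have h1 : ∫ x in T, fderiv ℝ (fun x => χ x * f x) x v = ∫ x in T, fderiv ℝ f x v :=
    setIntegral_congr_fun h.isOpen.measurableSet fun x hx => by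
      simp only [(hχ x (hTR (subset_closure hx))).fderiv_eq]
  rw [← h1, hmain]
  refine Finset.sum_congr rfl fun e he => ?_
  congr 1
  refine setIntegral_congr_fun (h.flat e he).isCompact.measurableSet fun x hx => ?_
  have hxT : x ∈ frontier T := h.frontier_eq ▸ mem_iUnion₂.2 ⟨e, he, hx⟩
  exact (hχ x (hTR (frontier_subset_closure hxT))).eq_of_nhds

end WG
end

/-! ### Polynomials, rigid motions and definite forms. -/

noncomputable section
namespace WG

variable {d : ℕ}

/-! ### Polynomials as functions -/

section Poly

open MvPolynomial

@[simp] theorem polyEval_add (p q : MvPolynomial (Fin d) ℝ) (x : Pt d) :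
    polyEval (p + q) x = polyEval p x + polyEval q x := by simp [polyEval]

@[simp] theorem polyEval_sub (p q : MvPolynomial (Fin d) ℝ) (x : Pt d) :
    polyEval (p - q) x = polyEval p x - polyEval q x := by simp [polyEval]

@[simp] theorem polyEval_mul (p q : MvPolynomial (Fin d) ℝ) (x : Pt d) :
    polyEval (p * q) x = polyEval p x * polyEval q x := by simp [polyEval]

@[simp] theorem polyEval_smul (c : ℝ) (p : MvPolynomial (Fin d) ℝ) (x : Pt d) :
    polyEval (c • p) x = c * polyEval p x := by simp [polyEval]

@[simp] theorem polyEval_zero (x : Pt d) : polyEval 0 x = 0 := by simp [polyEval]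

@[simp] theorem polyEval_C (c : ℝ) (x : Pt d) : polyEval (C c) x = c := by simp [polyEval]

@[simp] theorem polyEval_X (i : Fin d) (x : Pt d) : polyEval (X i) x = x i := by simp [polyEval]

@[simp] theorem polyEval_sum {α : Type*} (s : Finset α) (p : α → MvPolynomial (Fin d) ℝ)
    (x : Pt d) : polyEval (∑ a ∈ s, p a) x = ∑ a ∈ s, polyEval (p a) x := by simp [polyEval]

@[simp] theorem polyVec_apply (q : Fin d → MvPolynomial (Fin d) ℝ) (x : Pt d) (i : Fin d) :
    polyVec q x i = polyEval (q i) x := rfl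

theorem hasFDerivAt_polyEval (p : MvPolynomial (Fin d) ℝ) (x : Pt d) :
    HasFDerivAt (polyEval p) (∑ i, polyEval (pderiv i p) x • EuclideanSpace.proj (𝕜 := ℝ) i) x := by
  classical
  induction p using MvPolynomial.induction_on with
  | C a =>
    have : polyEval (C a : MvPolynomial (Fin d) ℝ) = fun _ => a := by ext; simp
    rw [this]
    simpa using hasFDerivAt_const a x
  | add p q hp hq =>
    have : polyEval (p + q) = fun x => polyEval p x + polyEval q x := by ext; simp
    rw [this]
    refine (hp.add hq).congr_fderiv ?_
    simp [add_smul, Finset.sum_add_distrib]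
  | mul_X p j hp =>
    have : polyEval (p * X j) = fun x => polyEval p x * x j := by ext; simp
    rw [this]
    have hj : HasFDerivAt (fun x : Pt d => x j) (EuclideanSpace.proj (𝕜 := ℝ) j) x :=
      (EuclideanSpace.proj (𝕜 := ℝ) j).hasFDerivAt
    refine (hp.mul hj).congr_fderiv ?_
    ext w
    simp only [pderiv_mul, pderiv_X, polyEval_add, polyEval_mul, polyEval_X, add_smul,
      Finset.sum_add_distrib, add_apply, sum_apply, smul_apply, PiLp.proj_apply, smul_eq_mul, Finset.mul_sum]
    rw [add_comm]
    congr 1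
    · exact Finset.sum_congr rfl fun i _ => by ring
    · rw [Finset.sum_eq_single j]
      · simp [polyEval]
      · intro b _ hb
        simp [hb.symm]
      · simp

theorem contDiff_polyEval (p : MvPolynomial (Fin d) ℝ) {n : WithTop ℕ∞} :
    ContDiff ℝ n (polyEval p) := by
  induction p using MvPolynomial.induction_on with
  | C a =>
    have : polyEval (C a : MvPolynomial (Fin d) ℝ) = fun _ => a := by ext; simp
    rw [this]; fun_prop
  | add p q hp hq =>
    have : polyEval (p + q) = fun x => polyEval p x + polyEval q x := by ext; simp
    rw [this]; fun_prop
  | mul_X p j hp =>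
    have : polyEval (p * X j) = fun x => polyEval p x * x j := by ext; simp
    rw [this]; fun_prop

@[fun_prop]
theorem continuous_polyEval (p : MvPolynomial (Fin d) ℝ) : Continuous (polyEval p) :=
  (contDiff_polyEval p (n := 0)).continuous

@[fun_prop]
theorem continuous_polyVec (q : Fin d → MvPolynomial (Fin d) ℝ) : Continuous (polyVec q) := by
  unfold polyVec
  fun_prop

theorem fderiv_polyEval_single (p : MvPolynomial (Fin d) ℝ) (x : Pt d) (j : Fin d) :
    fderiv ℝ (polyEval p) x (EuclideanSpace.single j 1) = polyEval (pderiv j p) x := by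
  classical
  rw [(hasFDerivAt_polyEval p x).fderiv]
  simp

/-- A polynomial that vanishes on a nonempty open set is zero. -/
theorem eq_zero_of_polyEval_eq_zero {p : MvPolynomial (Fin d) ℝ} {T : Set (Pt d)} (hT : IsOpen T)
    (hne : T.Nonempty) (h : ∀ x ∈ T, polyEval p x = 0) : p = 0 := by
  obtain ⟨y, hy⟩ := hne
  have hcont : Continuous fun u : Fin d → ℝ => (WithLp.toLp 2 u : Pt d) := by fun_prop
  obtain ⟨r, hr, hball⟩ := Metric.isOpen_iff.1 (hT.preimage hcont) y.ofLp (by simpa using hy)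
  -- A polynomial is determined by its values on a product of infinite sets, and a sup-norm ball is
  -- such a product.
  refine funext_set (fun i => Metric.ball (y i) r) (fun i => ?_) fun x hx => ?_
  · rw [Real.ball_eq_Ioo]
    exact Ioo_infinite (by linarith)
  · have hx' : x ∈ Metric.ball y.ofLp r := by
      rw [ball_pi _ hr]; exact hx
    have := h _ (hball hx')
    simpa [polyEval] using this

/-- In characteristic zero, a coefficient at an exponent `m` with `m i ≠ 0` is recovered from the
`i`-th derivative after division by `m i`. -/
theorem eq_C_of_pderiv_eq_zero {p : MvPolynomial (Fin d) ℝ} (h : ∀ i, pderiv i p = 0) :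
    p = C (coeff 0 p) := by
  classical
  ext m
  rw [coeff_C]
  split_ifs with hm
  · rw [hm]
  · obtain ⟨i, hi⟩ : ∃ i, m i ≠ 0 := by
      by_contra! hall
      exact hm (Finsupp.ext fun i => (hall i).symm)
    have h1 : m - Finsupp.single i 1 + Finsupp.single i 1 = m := by
      ext j
      by_cases hj : j = i
      · subst hj; simp; omega
      · simp [Ne.symm hj]
    have h2 := coeff_pderiv (i := i) p (m - Finsupp.single i 1)
    rw [h, h1, coeff_zero] at h2
    have h3 : (((m - Finsupp.single i 1 : Fin d →₀ ℕ) i : ℕ) : ℝ) + 1 ≠ 0 := by positivity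
    exact (mul_eq_zero.1 h2.symm).resolve_right h3

theorem pderiv_comm (i j : Fin d) (p : MvPolynomial (Fin d) ℝ) :
    pderiv i (pderiv j p) = pderiv j (pderiv i p) := by
  classical
  ext m
  simp only [coeff_pderiv, Finsupp.add_apply, Finsupp.single_apply]
  rw [add_right_comm]
  by_cases h : i = j
  · subst h; ring
  · simp [h, Ne.symm h]; ring

theorem totalDegree_pderiv_le {p : MvPolynomial (Fin d) ℝ} {r : ℕ} (h : p.totalDegree ≤ r)
    (i : Fin d) : (pderiv i p).totalDegree ≤ r - 1 := by
  classical
  refine Finset.sup_le fun m hm => ?_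
  rw [mem_support_iff, coeff_pderiv] at hm
  have h1 : m + Finsupp.single i 1 ∈ p.support := mem_support_iff.2 (left_ne_zero_of_mul hm)
  have h2 := (le_totalDegree h1).trans h
  rw [Finsupp.sum_add_index' (by simp) (by simp), Finsupp.sum_single_index rfl] at h2
  omega

/-- A polynomial vector field with vanishing symmetric gradient is a rigid motion. -/
theorem exists_rigidMotion {q : Fin d → MvPolynomial (Fin d) ℝ}
    (h : ∀ i j, pderiv j (q i) + pderiv i (q j) = 0) :
    ∃ (a : Pt d) (η : Matrix (Fin d) (Fin d) ℝ), η.transpose = -η ∧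
      ∀ x, polyVec q x = rigidMotion a η x := by
  classical
  have hs : ∀ i j, pderiv j (q i) = -pderiv i (q j) := fun i j => eq_neg_of_add_eq_zero_left (h i j)
  have h2 : ∀ i j k, pderiv k (pderiv j (q i)) = 0 := by
    intro i j k
    -- Alternating skew-symmetry with the exchange of derivatives permutes the three indices and
    -- returns to the start after an odd number of sign changes. All second derivatives therefore
    -- vanish.
    have e1 : pderiv k (pderiv j (q i)) = -pderiv k (pderiv j (q i)) := by
      calc pderiv k (pderiv j (q i)) = -pderiv k (pderiv i (q j)) := by rw [hs i j, map_neg]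
        _ = -pderiv i (pderiv k (q j)) := by rw [pderiv_comm]
        _ = pderiv i (pderiv j (q k)) := by rw [hs j k, map_neg, neg_neg]
        _ = pderiv j (pderiv i (q k)) := by rw [pderiv_comm]
        _ = -pderiv j (pderiv k (q i)) := by rw [hs k i, map_neg]
        _ = -pderiv k (pderiv j (q i)) := by rw [pderiv_comm]
    exact self_eq_neg.1 e1
  set η : Matrix (Fin d) (Fin d) ℝ := fun i j => coeff 0 (pderiv j (q i))
  have hη : ∀ i j, pderiv j (q i) = C (η i j) := fun i j => eq_C_of_pderiv_eq_zero (h2 i j)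
  have ha : ∀ i, q i - ∑ j, C (η i j) * X j =
      C (coeff 0 (q i - ∑ j, C (η i j) * X j)) := by
    intro i
    refine eq_C_of_pderiv_eq_zero fun k => ?_
    simp [hη, pderiv_X, Pi.single_apply]
  refine ⟨WithLp.toLp 2 fun i => coeff 0 (q i - ∑ j, C (η i j) * X j), η, ?_, fun x => ?_⟩
  · ext i j
    have := h i j
    rw [hη, hη, ← C_add] at this
    have h0 := C_eq_zero.1 this
    simp only [Matrix.transpose_apply, Matrix.neg_apply]
    linarith
  · ext i
    have := congrArg (polyEval · x) (ha i)
    simp only [polyEval_sub, polyEval_sum, polyEval_mul, polyEval_C, polyEval_X] at this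
    simp only [polyVec_apply, rigidMotion]
    linarith

/-- The components of a rigid motion as polynomials. -/
def rigidPoly (a : Pt d) (η : Matrix (Fin d) (Fin d) ℝ) (i : Fin d) : MvPolynomial (Fin d) ℝ :=
  C (a i) + ∑ j, C (η i j) * X j

theorem polyVec_rigidPoly (a : Pt d) (η : Matrix (Fin d) (Fin d) ℝ) (x : Pt d) :
    polyVec (rigidPoly a η) x = rigidMotion a η x := by
  ext i
  simp [rigidPoly, rigidMotion]

theorem totalDegree_rigidPoly_le (a : Pt d) (η : Matrix (Fin d) (Fin d) ℝ) (i : Fin d) :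
    (rigidPoly a η i).totalDegree ≤ 1 := by
  refine (totalDegree_add _ _).trans (max_le (by simp) ?_)
  refine totalDegree_finsetSum_le fun j _ => (totalDegree_mul _ _).trans ?_
  simp

/-- Skew-symmetry makes `η n` orthogonal to `n`, so `η (η n) = 0`. Then `|η n|² = -⟨η (η n), n⟩ =
0`, and `η` vanishes on `n` as well as on its complement. -/
theorem _root_.Matrix.eq_zero_of_skew_of_mulVec_eq_zero {η : Matrix (Fin d) (Fin d) ℝ}
    (hη : η.transpose = -η) {n : Fin d → ℝ} (hn : n ⬝ᵥ n = 1)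
    (h : ∀ w, n ⬝ᵥ w = 0 → η.mulVec w = 0) : η = 0 := by
  have hsk : ∀ w z, w ⬝ᵥ η.mulVec z = -(η.mulVec w ⬝ᵥ z) := by
    intro w z
    rw [Matrix.dotProduct_mulVec, ← Matrix.mulVec_transpose, hη, Matrix.neg_mulVec,
      neg_dotProduct]
  have h1 : n ⬝ᵥ η.mulVec n = 0 := by
    have := hsk n n
    rw [dotProduct_comm (η.mulVec n) n] at this
    linarith
  have h2 : η.mulVec n = 0 := by
    have := hsk (η.mulVec n) n
    rw [h _ h1, zero_dotProduct, neg_zero] at this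
    exact dotProduct_self_eq_zero.1 this
  have h3 : ∀ y, η.mulVec y = 0 := by
    intro y
    have e1 : η.mulVec (y - (n ⬝ᵥ y) • n) = 0 := h _ (by simp [dotProduct_sub, hn])
    rwa [Matrix.mulVec_sub, Matrix.mulVec_smul, h2, smul_zero, sub_zero] at e1
  ext i j
  have := congrFun (h3 (Pi.single j 1)) i
  simpa using this

/-- A rigid motion that vanishes on a flat face vanishes everywhere. -/
theorem IsFlatFace.rigidMotion_eq_zero {e : Set (Pt d)} (he : IsFlatFace e) {n : Pt d}
    (hn : IsUnitNormal e n) {a : Pt d} {η : Matrix (Fin d) (Fin d) ℝ} (hη : η.transpose = -η)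
    (h : ∀ x ∈ e, rigidMotion a η x = 0) (x : Pt d) : rigidMotion a η x = 0 := by
  obtain ⟨x₀, hx₀⟩ := he.nonempty
  -- The linear part kills differences of points of the face; these span the whole orthogonal
  -- complement of the normal.
  have hzero : ∀ w ∈ vectorSpan ℝ e, η.mulVec w.ofLp = 0 := by
    intro w hw
    rw [vectorSpan_eq_span_vsub_set_right ℝ hx₀] at hw
    induction hw using Submodule.span_induction with
    | mem w hw =>
      obtain ⟨y, hy, rfl⟩ := hw
      funext i
      have h1 := congrArg (fun u : Pt d => u i) (h y hy)
      have h2 := congrArg (fun u : Pt d => u i) (h x₀ hx₀)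
      simp only [rigidMotion, PiLp.zero_apply] at h1 h2
      simp only [Matrix.mulVec, dotProduct, vsub_eq_sub, PiLp.sub_apply, mul_sub,
        Finset.sum_sub_distrib, Pi.zero_apply]
      linarith
    | zero => simp
    | add u w _ _ hu hw => simp [Matrix.mulVec_add, hu, hw]
    | smul c w _ hw => simp [Matrix.mulVec_smul, hw]
  have hinner : ∀ w : Pt d, inner ℝ n w = n.ofLp ⬝ᵥ w.ofLp := by
    intro w
    simp [PiLp.inner_apply, dotProduct, mul_comm]
  have hη0 : η = 0 := by
    refine Matrix.eq_zero_of_skew_of_mulVec_eq_zero hη (n := n.ofLp) ?_ fun w hw => ?_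
    · rw [← hinner, real_inner_self_eq_norm_sq, hn.1]; norm_num
    · refine hzero (WithLp.toLp 2 w) ?_
      rw [he.vectorSpan_eq hn, Submodule.mem_orthogonal_singleton_iff_inner_right, hinner]
      exact hw
  subst hη0
  rw [← h x₀ hx₀]
  simp [rigidMotion]

end Poly

/-! ### Integrability and definiteness -/

theorem integrableOn_inner {μ : Measure (Pt d)} {A K : Set (Pt d)} (hA : MeasurableSet A)
    (hK : IsCompact K) (hAK : A ⊆ K) {g s : Pt d → Pt d} (hg : IntegrableOn g A μ)
    (hs : ContinuousOn s K) : IntegrableOn (fun x => inner ℝ (g x) (s x)) A μ := by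
  obtain ⟨B, hB⟩ := hK.exists_bound_of_continuousOn hs
  refine Integrable.mono' (hg.norm.mul_const B)
    (hg.aestronglyMeasurable.inner ((hs.mono hAK).aestronglyMeasurable hA)) ?_
  filter_upwards [ae_restrict_mem hA] with x hx
  exact (norm_inner_le_norm _ _).trans (by gcongr; exact hB x (hAK hx))

theorem integrableOn_of_continuousOn {F : Type*} [NormedAddCommGroup F]
    [SecondCountableTopology F] {μ : Measure (Pt d)} {K : Set (Pt d)} (hK : IsCompact K)
    (hμ : μ K < ⊤) {g : Pt d → F} (hg : ContinuousOn g K) : IntegrableOn g K μ := by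
  obtain ⟨B, hB⟩ := hK.exists_bound_of_continuousOn hg
  have : IsFiniteMeasure (μ.restrict K) := ⟨by simpa using hμ⟩
  refine Integrable.mono' (integrable_const B) (hg.aestronglyMeasurable hK.measurableSet) ?_
  filter_upwards [ae_restrict_mem hK.measurableSet] with x hx
  exact hB x hx

/-- A nonzero value would persist on a relatively open piece of the face, which has positive surface
measure by `IsFlatFace.surf_inter_pos`. -/
theorem IsFlatFace.eqOn_zero_of_integral_eq_zero {e : Set (Pt d)} (he : IsFlatFace e) {n : Pt d}
    (hn : IsUnitNormal e n) {g : Pt d → Pt d} (hg : ContinuousOn g e)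
    (h : ∫ x in e, inner ℝ (g x) (g x) ∂(surf d) = 0) : ∀ x ∈ e, g x = 0 := by
  have hm := he.isCompact.measurableSet
  have hcont : ContinuousOn (fun x => inner ℝ (g x) (g x)) e := hg.inner hg
  have hint := integrableOn_of_continuousOn he.isCompact (he.surf_lt_top hn) hcont
  have hae := (setIntegral_eq_zero_iff_of_nonneg_ae
    (Filter.Eventually.of_forall fun x => real_inner_self_nonneg) hint).1 h
  intro x hx
  by_contra hne
  obtain ⟨U, hU, hUe⟩ := (continuousOn_iff'.1 hg) {0}ᶜ isOpen_compl_singleton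
  have hpos := he.surf_inter_pos hn hU (by
    rw [inter_comm, ← hUe]; exact ⟨x, hne, hx⟩)
  have hnull : surf d (e ∩ U) = 0 := by
    have h1 := (ae_restrict_iff' hm).1 hae
    refine measure_mono_null (fun y hy => ?_) (ae_iff.1 h1)
    have hy' : y ∈ g ⁻¹' {0}ᶜ ∩ e := by rw [hUe, inter_comm]; exact hy
    have hy0 : g y ≠ 0 := hy'.1
    simpa [hy.1] using hy0
  exact hpos.ne' hnull

/-- No continuity of the weight is needed: positivity gives `g = 0` almost everywhere, and
continuity of `g` upgrades this on the open set. -/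
theorem eqOn_zero_of_weighted_integral_eq_zero {T : Set (Pt d)} (hT : IsOpen T)
    {w g : Pt d → ℝ} (hw : ∀ x ∈ T, 0 < w x) (hg : Continuous g) (hg0 : ∀ x, 0 ≤ g x)
    (hint : IntegrableOn (fun x => w x * g x) T) (h : ∫ x in T, w x * g x = 0) :
    ∀ x ∈ T, g x = 0 := by
  have hmem := ae_restrict_mem (μ := (volume : Measure (Pt d))) hT.measurableSet
  have hae := (setIntegral_eq_zero_iff_of_nonneg_ae (by
    filter_upwards [hmem] with x hx
    exact mul_nonneg (hw x hx).le (hg0 x)) hint).1 h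
  refine Measure.eqOn_open_of_ae_eq (μ := volume) (g := fun _ => (0 : ℝ)) ?_ hT hg.continuousOn
    continuousOn_const
  filter_upwards [hae, hmem] with x hx hxT
  exact (mul_eq_zero.1 hx).resolve_left (hw x hxT).ne'

/-! ### Riesz representation for definite bilinear forms -/

section Riesz

variable {X Y : Type*} [AddCommGroup X] [Module ℝ X] [AddCommGroup Y] [Module ℝ Y]

/-- `φ` is linear on the subspace `p`. -/
structure IsLinearOn (p : Submodule ℝ X) (φ : X → ℝ) : Prop where
  map_add : ∀ x ∈ p, ∀ y ∈ p, φ (x + y) = φ x + φ y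
  map_smul : ∀ (c : ℝ), ∀ x ∈ p, φ (c • x) = c * φ x

/-- `B` is bilinear on `p × q`. -/
structure IsBilinOn (p : Submodule ℝ X) (q : Submodule ℝ Y) (B : X → Y → ℝ) : Prop where
  left : ∀ y ∈ q, IsLinearOn p fun x => B x y
  right : ∀ x ∈ p, IsLinearOn q (B x)

variable {p : Submodule ℝ X} {q : Submodule ℝ Y}

theorem IsLinearOn.map_sub {φ : X → ℝ} (h : IsLinearOn p φ) {x y : X} (hx : x ∈ p) (hy : y ∈ p) :
    φ (x - y) = φ x - φ y := by
  have := h.map_add _ hx _ (p.smul_mem (-1) hy)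
  rw [h.map_smul (-1) _ hy] at this
  rw [sub_eq_add_neg, ← neg_one_smul ℝ y, this]
  ring

theorem IsLinearOn.mono {φ : X → ℝ} (h : IsLinearOn p φ) {p' : Submodule ℝ X} (hp : p' ≤ p) :
    IsLinearOn p' φ :=
  ⟨fun x hx y hy => h.1 x (hp hx) y (hp hy), fun c x hx => h.2 c x (hp hx)⟩

theorem IsBilinOn.mono {B : X → Y → ℝ} (h : IsBilinOn p q B) {p' : Submodule ℝ X}
    {q' : Submodule ℝ Y} (hp : p' ≤ p) (hq : q' ≤ q) : IsBilinOn p' q' B :=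
  ⟨fun y hy => (h.1 y (hq hy)).mono hp, fun x hx => (h.2 x (hp hx)).mono hq⟩

theorem IsLinearOn.add {φ ψ : X → ℝ} (h : IsLinearOn p φ) (h' : IsLinearOn p ψ) :
    IsLinearOn p fun x => φ x + ψ x :=
  ⟨fun x hx y hy => by rw [h.1 x hx y hy, h'.1 x hx y hy]; ring,
    fun c x hx => by rw [h.2 c x hx, h'.2 c x hx]; ring⟩

theorem IsLinearOn.const_mul {φ : X → ℝ} (h : IsLinearOn p φ) (a : ℝ) :
    IsLinearOn p fun x => a * φ x :=
  ⟨fun x hx y hy => by rw [h.1 x hx y hy]; ring, fun c x hx => by rw [h.2 c x hx]; ring⟩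

theorem IsLinearOn.sum {α : Type*} {s : Finset α} {φ : α → X → ℝ}
    (h : ∀ a ∈ s, IsLinearOn p (φ a)) : IsLinearOn p fun x => ∑ a ∈ s, φ a x :=
  ⟨fun x hx y hy => by
      rw [← Finset.sum_add_distrib]; exact Finset.sum_congr rfl fun a ha => (h a ha).1 x hx y hy,
    fun c x hx => by
      rw [Finset.mul_sum]; exact Finset.sum_congr rfl fun a ha => (h a ha).2 c x hx⟩

theorem IsBilinOn.add {B C : X → Y → ℝ} (h : IsBilinOn p q B) (h' : IsBilinOn p q C) :
    IsBilinOn p q fun x y => B x y + C x y :=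
  ⟨fun y hy => (h.1 y hy).add (h'.1 y hy), fun x hx => (h.2 x hx).add (h'.2 x hx)⟩

theorem IsBilinOn.const_mul {B : X → Y → ℝ} (h : IsBilinOn p q B) (a : ℝ) :
    IsBilinOn p q fun x y => a * B x y :=
  ⟨fun y hy => (h.1 y hy).const_mul a, fun x hx => (h.2 x hx).const_mul a⟩

theorem IsBilinOn.sum {α : Type*} {s : Finset α} {B : α → X → Y → ℝ}
    (h : ∀ a ∈ s, IsBilinOn p q (B a)) : IsBilinOn p q fun x y => ∑ a ∈ s, B a x y :=
  ⟨fun y hy => IsLinearOn.sum fun a ha => (h a ha).1 y hy,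
    fun x hx => IsLinearOn.sum fun a ha => (h a ha).2 x hx⟩

theorem IsBilinOn.eq_of_definite {B : X → X → ℝ} (hB : IsBilinOn p p B)
    (hdef : ∀ x ∈ p, B x x = 0 → x = 0) {x y : X} (hx : x ∈ p) (hy : y ∈ p)
    (h : ∀ z ∈ p, B x z = B y z) : x = y := by
  have hxy := p.sub_mem hx hy
  refine sub_eq_zero.1 (hdef _ hxy ?_)
  rw [(hB.1 _ hxy).map_sub hx hy, h _ hxy, sub_self]

/-- Definiteness makes the induced map from `p` to its dual injective, and equality of dimensions
makes it onto. Symmetry of the form plays no role. -/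
theorem IsBilinOn.exists_of_definite [FiniteDimensional ℝ p] {B : X → X → ℝ}
    (hB : IsBilinOn p p B) (hdef : ∀ x ∈ p, B x x = 0 → x = 0) {φ : X → ℝ}
    (hφ : IsLinearOn p φ) : ∃ x ∈ p, ∀ y ∈ p, B x y = φ y := by
  let L : p →ₗ[ℝ] Module.Dual ℝ p := LinearMap.mk₂ ℝ (fun x y : p => B x y)
    (fun x x' y => (hB.1 y y.2).1 x x.2 x' x'.2) (fun c x y => (hB.1 y y.2).2 c x x.2)
    (fun x y y' => (hB.2 x x.2).1 y y.2 y' y'.2) (fun c x y => (hB.2 x x.2).2 c y y.2)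
  let φ' : Module.Dual ℝ p :=
    { toFun := fun y => φ y
      map_add' := fun x y => hφ.1 x x.2 y y.2
      map_smul' := fun c x => hφ.2 c x x.2 }
  have hinj : Function.Injective L := by
    rw [← LinearMap.ker_eq_bot, LinearMap.ker_eq_bot']
    intro x hx
    exact Subtype.ext (hdef x x.2 (LinearMap.congr_fun hx x))
  obtain ⟨x, hx⟩ := (LinearMap.injective_iff_surjective_of_finrank_eq_finrank
    Subspace.dual_finrank_eq.symm).1 hinj φ'
  exact ⟨x, x.2, fun y hy => LinearMap.congr_fun hx ⟨y, hy⟩⟩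

/-- A representing map of a bilinear form is linear. -/
theorem IsBilinOn.linear_of_represents {B : X → X → ℝ} (hB : IsBilinOn p p B)
    (hdef : ∀ x ∈ p, B x x = 0 → x = 0) {F : Y → X → ℝ} (hF : IsBilinOn q p F) {R : Y → X}
    (hR : ∀ v ∈ q, R v ∈ p) (hRF : ∀ v ∈ q, ∀ x ∈ p, B (R v) x = F v x) :
    (∀ v ∈ q, ∀ w ∈ q, R (v + w) = R v + R w) ∧ ∀ (c : ℝ), ∀ v ∈ q, R (c • v) = c • R v := by
  constructor
  · intro v hv w hw
    refine hB.eq_of_definite hdef (hR _ (q.add_mem hv hw)) (p.add_mem (hR v hv) (hR w hw)) ?_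
    intro z hz
    rw [hRF _ (q.add_mem hv hw) z hz, (hB.1 z hz).1 _ (hR v hv) _ (hR w hw), hRF v hv z hz,
      hRF w hw z hz, (hF.1 z hz).1 v hv w hw]
  · intro c v hv
    refine hB.eq_of_definite hdef (hR _ (q.smul_mem c hv)) (p.smul_mem c (hR v hv)) ?_
    intro z hz
    rw [hRF _ (q.smul_mem c hv) z hz, (hB.1 z hz).2 c _ (hR v hv), hRF v hv z hz,
      (hF.1 z hz).2 c v hv]

theorem finiteDimensional_pi_univ {α : Type*} [Finite α] {V : α → Type*}
    [∀ a, AddCommGroup (V a)] [∀ a, Module ℝ (V a)] (s : ∀ a, Submodule ℝ (V a))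
    [∀ a, FiniteDimensional ℝ (s a)] : FiniteDimensional ℝ (Submodule.pi univ s) := by
  let f : (∀ a, s a) →ₗ[ℝ] ∀ a, V a :=
    LinearMap.pi fun a => (s a).subtype ∘ₗ LinearMap.proj a
  refine Submodule.finiteDimensional_of_le (S₂ := LinearMap.range f) fun x hx => ?_
  exact ⟨fun a => ⟨x a, hx a (mem_univ a)⟩, rfl⟩

end Riesz

end WG
end

/-! ### Discrete spaces, projections and weak operators. -/

noncomputable section
namespace WG

variable {d : ℕ}

/-! ### Bilinearity of integrals -/

section Combinators

variable {X Y : Type*} [AddCommGroup X] [Module ℝ X] [AddCommGroup Y] [Module ℝ Y]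
  {p : Submodule ℝ X} {q : Submodule ℝ Y} {μ : Measure (Pt d)} {A : Set (Pt d)}

theorem IsLinearOn.setIntegral {F : X → Pt d → ℝ} (hint : ∀ x ∈ p, IntegrableOn (F x) A μ)
    (hlin : ∀ z, IsLinearOn p fun x => F x z) : IsLinearOn p fun x => ∫ z in A, F x z ∂μ := by
  refine ⟨fun x hx y hy => ?_, fun c x hx => ?_⟩
  · rw [← integral_add (hint x hx) (hint y hy)]
    exact integral_congr_ae (Filter.Eventually.of_forall fun z => (hlin z).1 x hx y hy)
  · rw [← integral_const_mul]
    exact integral_congr_ae (Filter.Eventually.of_forall fun z => (hlin z).2 c x hx)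

theorem IsBilinOn.setIntegral {B : X → Y → Pt d → ℝ}
    (hint : ∀ x ∈ p, ∀ y ∈ q, IntegrableOn (B x y) A μ)
    (hlin : ∀ z, IsBilinOn p q fun x y => B x y z) :
    IsBilinOn p q fun x y => ∫ z in A, B x y z ∂μ :=
  ⟨fun y hy => IsLinearOn.setIntegral (fun x hx => hint x hx y hy) fun z => (hlin z).1 y hy,
    fun x hx => IsLinearOn.setIntegral (fun y hy => hint x hx y hy) fun z => (hlin z).2 x hx⟩

theorem IsBilinOn.mul {φ : X → ℝ} {ψ : Y → ℝ} (hφ : IsLinearOn p φ) (hψ : IsLinearOn q ψ) :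
    IsBilinOn p q fun x y => φ x * ψ y :=
  ⟨fun y _ => ⟨fun x hx x' hx' => by rw [hφ.1 x hx x' hx']; ring,
      fun c x hx => by rw [hφ.2 c x hx]; ring⟩,
    fun x _ => ⟨fun y hy y' hy' => by rw [hψ.1 y hy y' hy']; ring,
      fun c y hy => by rw [hψ.2 c y hy]; ring⟩⟩

theorem IsBilinOn.inner {φ : X → Pt d} {ψ : Y → Pt d}
    (hφ : ∀ x ∈ p, ∀ y ∈ p, φ (x + y) = φ x + φ y) (hφ' : ∀ (c : ℝ), ∀ x ∈ p, φ (c • x) = c • φ x)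
    (hψ : ∀ x ∈ q, ∀ y ∈ q, ψ (x + y) = ψ x + ψ y) (hψ' : ∀ (c : ℝ), ∀ x ∈ q, ψ (c • x) = c • ψ x) :
    IsBilinOn p q fun x y => inner ℝ (φ x) (ψ y) :=
  ⟨fun y _ => ⟨fun x hx x' hx' => by rw [hφ x hx x' hx', inner_add_left],
      fun c x hx => by rw [hφ' c x hx, real_inner_smul_left]⟩,
    fun x _ => ⟨fun y hy y' hy' => by rw [hψ y hy y' hy', inner_add_right],
      fun c y hy => by rw [hψ' c y hy, real_inner_smul_right]⟩⟩

theorem IsBilinOn.neg {B : X → Y → ℝ} (h : IsBilinOn p q B) : IsBilinOn p q fun x y => -B x y := by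
  simpa using h.const_mul (-1)

end Combinators

/-- The vector fields integrable on `A`. -/
def integrableFields (μ : Measure (Pt d)) (A : Set (Pt d)) : Submodule ℝ (Pt d → Pt d) where
  carrier := {g | IntegrableOn g A μ}
  add_mem' := fun h h' => Integrable.add h h'
  zero_mem' := integrableOn_zero
  smul_mem' := fun c _ h => Integrable.smul c h

/-- The vector fields continuous on `K`. -/
def continuousFields (K : Set (Pt d)) : Submodule ℝ (Pt d → Pt d) where
  carrier := {g | ContinuousOn g K}
  add_mem' := fun h h' => ContinuousOn.add h h'
  zero_mem' := continuousOn_const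
  smul_mem' := fun c _ h => ContinuousOn.const_smul h c

theorem isBilinOn_setIntegral_inner {μ : Measure (Pt d)} {A K : Set (Pt d)} (hA : MeasurableSet A)
    (hK : IsCompact K) (hAK : A ⊆ K) :
    IsBilinOn (integrableFields μ A) (continuousFields K)
      fun g s => ∫ x in A, inner ℝ (g x) (s x) ∂μ :=
  IsBilinOn.setIntegral (fun _ hg _ hs => integrableOn_inner hA hK hAK hg hs) fun _ =>
    IsBilinOn.inner (fun _ _ _ _ => rfl) (fun _ _ _ => rfl) (fun _ _ _ _ => rfl) fun _ _ _ => rfl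

/-! ### The face spaces and the projections onto them -/

theorem polyVec_add (q r : Fin d → MvPolynomial (Fin d) ℝ) (x : Pt d) :
    polyVec (q + r) x = polyVec q x + polyVec r x := by
  ext i; simp

theorem polyVec_smul (c : ℝ) (q : Fin d → MvPolynomial (Fin d) ℝ) (x : Pt d) :
    polyVec (c • q) x = c • polyVec q x := by
  ext i; simp

theorem polyVec_zero (x : Pt d) : polyVec (0 : Fin d → MvPolynomial (Fin d) ℝ) x = 0 := by
  ext i; simp

theorem rigidMotion_add (a b : Pt d) (η θ : Matrix (Fin d) (Fin d) ℝ) (x : Pt d) :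
    rigidMotion (a + b) (η + θ) x = rigidMotion a η x + rigidMotion b θ x := by
  ext i
  simp only [rigidMotion, PiLp.add_apply, Matrix.add_apply, add_mul, Finset.sum_add_distrib]
  ring

theorem rigidMotion_smul (c : ℝ) (a : Pt d) (η : Matrix (Fin d) (Fin d) ℝ) (x : Pt d) :
    rigidMotion (c • a) (c • η) x = c • rigidMotion a η x := by
  ext i
  simp only [rigidMotion, PiLp.smul_apply, Matrix.smul_apply, smul_eq_mul, mul_add, Finset.mul_sum,
    mul_assoc]

/-- The space `S_k(e)` as a subspace. -/
def faceSubmodule (k : ℕ) (e : Set (Pt d)) : Submodule ℝ (Pt d → Pt d) where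
  carrier := faceSpace k e
  add_mem' := by
    rintro _ _ ⟨q, a, η, hq, hη, rfl⟩ ⟨r, b, θ, hr, hθ, rfl⟩
    refine ⟨q + r, a + b, η + θ, fun i => (MvPolynomial.totalDegree_add _ _).trans
      (max_le (hq i) (hr i)), by rw [Matrix.transpose_add, hη, hθ]; abel, ?_⟩
    funext x
    by_cases hx : x ∈ e
    · simp only [Pi.add_apply, indicator_of_mem hx, polyVec_add, rigidMotion_add]
      abel
    · simp [hx]
  zero_mem' := ⟨0, 0, 0, by simp, by simp, by
    ext x i
    by_cases hx : x ∈ e <;> simp [hx, rigidMotion]⟩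
  smul_mem' := by
    rintro c _ ⟨q, a, η, hq, hη, rfl⟩
    refine ⟨c • q, c • a, c • η, fun i => (MvPolynomial.totalDegree_smul_le _ _).trans (hq i),
      by rw [Matrix.transpose_smul, hη, smul_neg], ?_⟩
    funext x
    by_cases hx : x ∈ e
    · simp only [Pi.smul_apply, indicator_of_mem hx, polyVec_smul, rigidMotion_smul, smul_add]
    · simp [hx]

theorem continuousOn_of_mem_faceSpace {k : ℕ} {e : Set (Pt d)} {v : Pt d → Pt d}
    (hv : v ∈ faceSpace k e) : ContinuousOn v e := by
  obtain ⟨q, a, η, -, -, rfl⟩ := hv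
  have hc : Continuous fun x => polyVec q x + rigidMotion a η x := by
    simp only [← polyVec_rigidPoly]
    fun_prop
  exact hc.continuousOn.congr fun x hx => indicator_of_mem hx _

theorem eq_zero_of_mem_faceSpace {k : ℕ} {e : Set (Pt d)} {v : Pt d → Pt d}
    (hv : v ∈ faceSpace k e) (h : ∀ x ∈ e, v x = 0) : v = 0 := by
  funext x
  by_cases hx : x ∈ e
  · exact h x hx
  · obtain ⟨q, a, η, -, -, rfl⟩ := hv
    exact indicator_of_notMem hx _

/-- Rigid motions are polynomials of degree at most one, so all members are restrictions of
polynomial fields of degree at most `k + 1`, a crude bound for both `k - 1` and `1`. -/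
instance finiteDimensional_faceSubmodule (k : ℕ) (e : Set (Pt d)) :
    FiniteDimensional ℝ (faceSubmodule k e) := by
  let L : (Fin d → MvPolynomial (Fin d) ℝ) →ₗ[ℝ] Pt d → Pt d :=
    { toFun := fun q => e.indicator (polyVec q)
      map_add' := fun q r => by
        funext x
        by_cases hx : x ∈ e <;> simp [hx, polyVec_add]
      map_smul' := fun c q => by
        funext x
        by_cases hx : x ∈ e <;> simp [hx, polyVec_smul] }
  have : FiniteDimensional ℝ (Submodule.pi univ
      fun _ : Fin d => MvPolynomial.restrictTotalDegree (Fin d) ℝ (k + 1)) :=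
    finiteDimensional_pi_univ _
  refine Submodule.finiteDimensional_of_le (S₂ := (Submodule.pi univ
      fun _ : Fin d => MvPolynomial.restrictTotalDegree (Fin d) ℝ (k + 1)).map L) ?_
  rintro _ ⟨q, a, η, hq, -, rfl⟩
  refine ⟨q + rigidPoly a η, fun i _ => ?_, ?_⟩
  · refine (MvPolynomial.mem_restrictTotalDegree _ _ _).2 ?_
    exact (MvPolynomial.totalDegree_add _ _).trans (max_le ((hq i).trans (by omega))
      ((totalDegree_rigidPoly_le a η i).trans (by omega)))
  · change e.indicator _ = e.indicator _
    congr 1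
    funext x
    rw [polyVec_add, polyVec_rigidPoly]

section Proj

variable {k : ℕ} {e : Set (Pt d)} {n : Pt d}

theorem IsFlatFace.continuousFields_le (he : IsFlatFace e) (hn : IsUnitNormal e n) :
    continuousFields e ≤ integrableFields (surf d) e := fun _ hg =>
  integrableOn_of_continuousOn he.isCompact (he.surf_lt_top hn) hg

theorem faceSubmodule_le : faceSubmodule k e ≤ continuousFields e := fun _ hv =>
  continuousOn_of_mem_faceSpace hv

theorem IsFlatFace.isBilinOn_inner (he : IsFlatFace e) :
    IsBilinOn (integrableFields (surf d) e) (faceSubmodule k e)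
      fun g s => ∫ x in e, inner ℝ (g x) (s x) ∂(surf d) :=
  (isBilinOn_setIntegral_inner he.isCompact.measurableSet he.isCompact subset_rfl).mono le_rfl
    faceSubmodule_le

theorem IsFlatFace.isBilinOn_inner_self (he : IsFlatFace e) (hn : IsUnitNormal e n) :
    IsBilinOn (faceSubmodule k e) (faceSubmodule k e)
      fun g s => ∫ x in e, inner ℝ (g x) (s x) ∂(surf d) :=
  he.isBilinOn_inner.mono (faceSubmodule_le.trans (he.continuousFields_le hn)) le_rfl

theorem IsFlatFace.faceInner_definite (he : IsFlatFace e) (hn : IsUnitNormal e n) :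
    ∀ v ∈ faceSubmodule k e, ∫ x in e, inner ℝ (v x) (v x) ∂(surf d) = 0 → v = 0 := fun _ hv h =>
  eq_zero_of_mem_faceSpace hv
    (he.eqOn_zero_of_integral_eq_zero hn (continuousOn_of_mem_faceSpace hv) h)

theorem IsFlatFace.isFaceProj_faceProj (he : IsFlatFace e) (hn : IsUnitNormal e n)
    {g : Pt d → Pt d} (hg : IntegrableOn g e (surf d)) : IsFaceProj k e g (faceProj k e g) :=
  Classical.epsilon_spec (p := IsFaceProj k e g) <|
    (he.isBilinOn_inner_self hn).exists_of_definite (he.faceInner_definite hn)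
      (he.isBilinOn_inner.2 g hg)

/-- The projection fixes the face space. It is used for rigid motions, whose projected traces are
thus their true traces; agreement on `e` suffices because members of the face space are extended by
zero. -/
theorem IsFlatFace.faceProj_eq_of_mem (he : IsFlatFace e) (hn : IsUnitNormal e n)
    {g v : Pt d → Pt d} (hv : v ∈ faceSpace k e) (hgv : EqOn g v e) : faceProj k e g = v := by
  have hg : IntegrableOn g e (surf d) :=
    (he.continuousFields_le hn) ((continuousOn_of_mem_faceSpace hv).congr hgv)
  have hp := he.isFaceProj_faceProj (k := k) hn hg
  refine (he.isBilinOn_inner_self hn).eq_of_definite (he.faceInner_definite hn) hp.1 hv ?_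
  intro s hs
  rw [hp.2 s hs]
  exact setIntegral_congr_fun he.isCompact.measurableSet fun x hx => by simp only [hgv hx]

theorem IsFlatFace.faceProj_linear (he : IsFlatFace e) (hn : IsUnitNormal e n) :
    (∀ g ∈ integrableFields (surf d) e, ∀ g' ∈ integrableFields (surf d) e,
      faceProj k e (g + g') = faceProj k e g + faceProj k e g') ∧
    ∀ (c : ℝ), ∀ g ∈ integrableFields (surf d) e, faceProj k e (c • g) = c • faceProj k e g :=
  (he.isBilinOn_inner_self hn).linear_of_represents (he.faceInner_definite hn) he.isBilinOn_inner
    (fun _ hg => (he.isFaceProj_faceProj hn hg).1) fun _ hg => (he.isFaceProj_faceProj hn hg).2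

end Proj

/-! ### The vector space of weak functions -/

section WeakFn

variable {ι κ : Type*}

/-- A weak function as a pair. -/
def WeakFn.equivProd : WeakFn d ι κ ≃
    (ι → Fin d → MvPolynomial (Fin d) ℝ) × (ι → κ → Pt d → Pt d) where
  toFun v := (v.v0, v.vb)
  invFun p := ⟨p.1, p.2⟩
  left_inv _ := rfl
  right_inv _ := rfl

instance : AddCommGroup (WeakFn d ι κ) := WeakFn.equivProd.addCommGroup

instance : Module ℝ (WeakFn d ι κ) := WeakFn.equivProd.module ℝ

@[simp] theorem WeakFn.v0_add (u v : WeakFn d ι κ) : (u + v).v0 = u.v0 + v.v0 := rfl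
@[simp] theorem WeakFn.vb_add (u v : WeakFn d ι κ) : (u + v).vb = u.vb + v.vb := rfl
@[simp] theorem WeakFn.v0_smul (c : ℝ) (v : WeakFn d ι κ) : (c • v).v0 = c • v.v0 := rfl
@[simp] theorem WeakFn.vb_smul (c : ℝ) (v : WeakFn d ι κ) : (c • v).vb = c • v.vb := rfl
@[simp] theorem WeakFn.v0_zero : (0 : WeakFn d ι κ).v0 = 0 := rfl
@[simp] theorem WeakFn.vb_zero : (0 : WeakFn d ι κ).vb = 0 := rfl
@[simp] theorem WeakFn.v0_sub (u v : WeakFn d ι κ) : (u - v).v0 = u.v0 - v.v0 := rfl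
@[simp] theorem WeakFn.vb_sub (u v : WeakFn d ι κ) : (u - v).vb = u.vb - v.vb := rfl

theorem WeakFn.isLinearOn_v0 (p : Submodule ℝ (WeakFn d ι κ)) (T : ι) (i : Fin d) (x : Pt d) :
    IsLinearOn p fun v => polyEval (v.v0 T i) x :=
  ⟨fun u _ v _ => by simp, fun c v _ => by simp⟩

theorem WeakFn.isLinearOn_vb (p : Submodule ℝ (WeakFn d ι κ)) (T : ι) (e : κ) (i : Fin d)
    (x : Pt d) : IsLinearOn p fun v => v.vb T e x i :=
  ⟨fun u _ v _ => by simp, fun c v _ => by simp⟩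

end WeakFn

/-! ### The mesh -/

section Mesh

variable {N M : ℕ} {G : InterfaceGeometry d N M} {ι κ : Type*}
  (𝒯 : PolyMesh G ι κ)

theorem PolyMesh.isBounded_elem (T : ι) : Bornology.IsBounded (𝒯.elem T) := by
  obtain ⟨i, hi⟩ := 𝒯.elem_aligned T
  exact G.isBounded_Ω.subset (hi.trans (G.sub_subset i))

theorem PolyMesh.nonempty_elem (T : ι) : (𝒯.elem T).Nonempty := (𝒯.elem_domain T).isConnected.nonempty

theorem PolyMesh.isOpen_elem (T : ι) : IsOpen (𝒯.elem T) := (𝒯.elem_domain T).isOpen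

theorem PolyMesh.integrableOn_elem (T : ι) {g : Pt d → ℝ} (hg : Continuous g) :
    IntegrableOn g (𝒯.elem T) :=
  (hg.continuousOn.integrableOn_compact (𝒯.isBounded_elem T).isCompact_closure).mono_set
    subset_closure

theorem PolyMesh.integrableOn_elem_mul (T : ι) {w g : Pt d → ℝ} (hw : IntegrableOn w (𝒯.elem T))
    (hg : Continuous g) : IntegrableOn (fun x => w x * g x) (𝒯.elem T) :=
  hw.mul_continuousOn_of_subset hg.continuousOn (𝒯.isOpen_elem T).measurableSet
    (𝒯.isBounded_elem T).isCompact_closure subset_closure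

theorem PolyMesh.isBilinOn_polyInner (T : ι) (p q : Submodule ℝ (MvPolynomial (Fin d) ℝ)) :
    IsBilinOn p q fun D w => ∫ x in 𝒯.elem T, polyEval D x * polyEval w x :=
  IsBilinOn.setIntegral (fun _ _ _ _ => 𝒯.integrableOn_elem T (by fun_prop)) fun z =>
    IsBilinOn.mul ⟨by simp, by simp⟩ ⟨by simp, by simp⟩

theorem PolyMesh.polyInner_definite (T : ι) {D : MvPolynomial (Fin d) ℝ}
    (h : ∫ x in 𝒯.elem T, polyEval D x * polyEval D x = 0) : D = 0 := by
  refine eq_zero_of_polyEval_eq_zero (𝒯.isOpen_elem T) (𝒯.nonempty_elem T) fun x hx => ?_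
  have := eqOn_zero_of_weighted_integral_eq_zero (𝒯.isOpen_elem T) (w := fun _ => 1)
    (g := fun x => polyEval D x * polyEval D x) (by simp) (by fun_prop)
    (fun x => mul_self_nonneg _) (𝒯.integrableOn_elem T (by fun_prop)) (by simpa using h) x hx
  exact mul_self_eq_zero.1 this

theorem PolyMesh.isBilinOn_strainInner (T : ι)
    (p q : Submodule ℝ (Matrix (Fin d) (Fin d) (MvPolynomial (Fin d) ℝ))) :
    IsBilinOn p q fun S w => ∫ x in 𝒯.elem T, ∑ i, ∑ j, polyEval (S i j) x * polyEval (w i j) x :=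
  IsBilinOn.setIntegral (fun _ _ _ _ => 𝒯.integrableOn_elem T (by fun_prop)) fun z =>
    IsBilinOn.sum fun i _ => IsBilinOn.sum fun j _ => IsBilinOn.mul ⟨by simp, by simp⟩
      ⟨by simp, by simp⟩

theorem PolyMesh.weighted_strainInner_definite (T : ι) {w : Pt d → ℝ}
    (hw : ∀ x ∈ 𝒯.elem T, 0 < w x) (hint : IntegrableOn w (𝒯.elem T))
    {S : Matrix (Fin d) (Fin d) (MvPolynomial (Fin d) ℝ)}
    (h : ∫ x in 𝒯.elem T, w x * ∑ i, ∑ j, polyEval (S i j) x * polyEval (S i j) x = 0) :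
    S = 0 := by
  have h0 := eqOn_zero_of_weighted_integral_eq_zero (𝒯.isOpen_elem T) hw
    (g := fun x => ∑ i, ∑ j, polyEval (S i j) x * polyEval (S i j) x) (by fun_prop)
    (fun x => Finset.sum_nonneg fun i _ => Finset.sum_nonneg fun j _ => mul_self_nonneg _)
    (𝒯.integrableOn_elem_mul T hint (by fun_prop)) h
  ext1 i j
  refine eq_zero_of_polyEval_eq_zero (𝒯.isOpen_elem T) (𝒯.nonempty_elem T) fun x hx => ?_
  have h1 := (Finset.sum_eq_zero_iff_of_nonneg fun i _ => Finset.sum_nonneg fun j _ =>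
    mul_self_nonneg _).1 (h0 x hx) i (Finset.mem_univ i)
  have h2 := (Finset.sum_eq_zero_iff_of_nonneg fun j _ => mul_self_nonneg _).1 h1 j
    (Finset.mem_univ j)
  exact mul_self_eq_zero.1 h2

theorem PolyMesh.strainInner_definite (T : ι)
    {S : Matrix (Fin d) (Fin d) (MvPolynomial (Fin d) ℝ)}
    (h : ∫ x in 𝒯.elem T, ∑ i, ∑ j, polyEval (S i j) x * polyEval (S i j) x = 0) : S = 0 :=
  𝒯.weighted_strainInner_definite T (w := fun _ => 1) (by simp)
    (𝒯.integrableOn_elem T continuous_const) (by simpa using h)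

variable [Fintype κ]

theorem PolyMesh.mem_facesOf {T : ι} {e : κ} :
    e ∈ 𝒯.facesOf T ↔ 𝒯.face e ⊆ frontier (𝒯.elem T) := by
  simp [PolyMesh.facesOf]

variable {𝒯} in
theorem PolyMesh.isUnitNormal {T : ι} {e : κ} (he : e ∈ 𝒯.facesOf T) :
    IsUnitNormal (𝒯.face e) (𝒯.normal T e) :=
  (𝒯.normal_spec T e (𝒯.mem_facesOf.1 he)).isUnitNormal

theorem PolyMesh.hasFlatBoundary (T : ι) :
    HasFlatBoundary (𝒯.elem T) (𝒯.facesOf T) 𝒯.face (𝒯.normal T) where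
  isOpen := 𝒯.isOpen_elem T
  isBounded := 𝒯.isBounded_elem T
  flat e _ := 𝒯.face_flat e
  disjoint e _ e' _ h := 𝒯.face_disjoint h
  frontier_eq := by
    rw [𝒯.frontier_elem T]
    simp [𝒯.mem_facesOf]
  normal_spec e he := 𝒯.normal_spec T e (𝒯.mem_facesOf.1 he)

theorem PolyMesh.exists_mem_facesOf (e : κ) : ∃ T, e ∈ 𝒯.facesOf T := by
  by_cases h : 𝒯.face e ⊆ frontier G.Ω
  · obtain ⟨T, hT, -⟩ := 𝒯.boundary_face e h
    exact ⟨T, 𝒯.mem_facesOf.2 hT⟩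
  · obtain ⟨T, T', -, hT⟩ := 𝒯.interior_face e h
    exact ⟨T, 𝒯.mem_facesOf.2 ((hT T).2 (Or.inl rfl))⟩

theorem PolyMesh.exists_isUnitNormal (e : κ) : ∃ n, IsUnitNormal (𝒯.face e) n := by
  obtain ⟨T, hT⟩ := 𝒯.exists_mem_facesOf e
  exact ⟨_, PolyMesh.isUnitNormal hT⟩

/-- Integration by parts for polynomials on an element. -/
theorem PolyMesh.setIntegral_pderiv (T : ι) (p : MvPolynomial (Fin d) ℝ) (j : Fin d) :
    ∫ x in 𝒯.elem T, polyEval (MvPolynomial.pderiv j p) x =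
      ∑ e ∈ 𝒯.facesOf T, 𝒯.normal T e j * ∫ x in 𝒯.face e, polyEval p x ∂(surf d) := by
  have h := (𝒯.hasFlatBoundary T).setIntegral_fderiv (EuclideanSpace.single j 1)
    (contDiff_polyEval p)
  simpa [fderiv_polyEval_single, EuclideanSpace.inner_single_right] using h

theorem PolyMesh.integrableOn_face (e : κ) {g : Pt d → ℝ} (hg : ContinuousOn g (𝒯.face e)) :
    IntegrableOn g (𝒯.face e) (surf d) := by
  obtain ⟨n, hn⟩ := 𝒯.exists_isUnitNormal e
  exact integrableOn_of_continuousOn (𝒯.face_flat e).isCompact ((𝒯.face_flat e).surf_lt_top hn) hg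

/-- The space `W_h`. -/
def PolyMesh.W (k : ℕ) : Submodule ℝ (WeakFn d ι κ) where
  carrier := {v | MemW 𝒯 k v}
  add_mem' {u v} hu hv :=
    { degree_le := fun T i => (MvPolynomial.totalDegree_add _ _).trans
        (max_le (hu.degree_le T i) (hv.degree_le T i))
      mem_faceSpace := fun T e he =>
        (faceSubmodule k (𝒯.face e)).add_mem (hu.mem_faceSpace T e he) (hv.mem_faceSpace T e he)
      eq_zero := fun T e he => by simp [hu.eq_zero T e he, hv.eq_zero T e he]
      single_valued := fun e T T' i h1 h2 h3 h4 => by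
        simp [hu.single_valued e T T' i h1 h2 h3 h4, hv.single_valued e T T' i h1 h2 h3 h4] }
  zero_mem' :=
    { degree_le := fun T i => by simp
      mem_faceSpace := fun T e he => (faceSubmodule k (𝒯.face e)).zero_mem
      eq_zero := fun T e he => rfl
      single_valued := fun e T T' i h1 h2 h3 h4 => rfl }
  smul_mem' c v hv :=
    { degree_le := fun T i => (MvPolynomial.totalDegree_smul_le _ _).trans (hv.degree_le T i)
      mem_faceSpace := fun T e he =>
        (faceSubmodule k (𝒯.face e)).smul_mem c (hv.mem_faceSpace T e he)
      eq_zero := fun T e he => by simp [hv.eq_zero T e he]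
      single_valued := fun e T T' i h1 h2 h3 h4 => by
        simp [hv.single_valued e T T' i h1 h2 h3 h4] }

/-- The space `W_h^0`. -/
def PolyMesh.W0 (k : ℕ) : Submodule ℝ (WeakFn d ι κ) where
  carrier := {v | MemW0 𝒯 k v}
  add_mem' {u v} hu hv :=
    { memW := (𝒯.W k).add_mem hu.memW hv.memW
      boundary := fun T e he h => by simp [hu.boundary T e he h, hv.boundary T e he h]
      single_valued_all := fun e T T' h1 h2 => by
        simp [hu.single_valued_all e T T' h1 h2, hv.single_valued_all e T T' h1 h2] }
  zero_mem' :=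
    { memW := (𝒯.W k).zero_mem
      boundary := fun T e he h => rfl
      single_valued_all := fun e T T' h1 h2 => rfl }
  smul_mem' c v hv :=
    { memW := (𝒯.W k).smul_mem c hv.memW
      boundary := fun T e he h => by simp [hv.boundary T e he h]
      single_valued_all := fun e T T' h1 h2 => by simp [hv.single_valued_all e T T' h1 h2] }

theorem PolyMesh.W0_le_W (k : ℕ) : 𝒯.W0 k ≤ 𝒯.W k := fun _ hv => hv.memW

instance PolyMesh.finiteDimensional_W [Finite ι] (k : ℕ) : FiniteDimensional ℝ (𝒯.W k) := by
  let f : 𝒯.W k →ₗ[ℝ] (ι → Fin d → MvPolynomial.restrictTotalDegree (Fin d) ℝ k) ×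
      (ι → ∀ e : κ, faceSubmodule k (𝒯.face e)) :=
    { toFun := fun v => (fun T i => ⟨v.1.v0 T i, (MvPolynomial.mem_restrictTotalDegree _ _ _).2
        (v.2.degree_le T i)⟩, fun T e => ⟨v.1.vb T e, by
          by_cases he : e ∈ 𝒯.facesOf T
          · exact v.2.mem_faceSpace T e he
          · rw [v.2.eq_zero T e he]; exact (faceSubmodule k (𝒯.face e)).zero_mem⟩)
      map_add' := fun _ _ => rfl
      map_smul' := fun _ _ => rfl }
  refine FiniteDimensional.of_injective f fun u v huv => ?_
  apply Subtype.ext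
  have h1 := congrArg Prod.fst huv
  have h2 := congrArg Prod.snd huv
  refine WeakFn.ext ?_ ?_
  · funext T i
    exact congrArg Subtype.val (congrFun (congrFun h1 T) i)
  · funext T e
    exact congrArg Subtype.val (congrFun (congrFun h2 T) e)

instance PolyMesh.finiteDimensional_W0 [Finite ι] (k : ℕ) : FiniteDimensional ℝ (𝒯.W0 k) :=
  Submodule.finiteDimensional_of_le (𝒯.W0_le_W k)

variable {𝒯} in
theorem MemW.continuousOn {k : ℕ} {v : WeakFn d ι κ} (hv : MemW 𝒯 k v) {T : ι} {e : κ}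
    (he : e ∈ 𝒯.facesOf T) : ContinuousOn (v.vb T e) (𝒯.face e) :=
  continuousOn_of_mem_faceSpace (hv.mem_faceSpace T e he)

/-! ### The discrete weak divergence -/

theorem PolyMesh.isBilinOn_divFunctional (k : ℕ) (T : ι)
    (p : Submodule ℝ (MvPolynomial (Fin d) ℝ)) :
    IsBilinOn (𝒯.W k) p fun v w =>
      -(∫ x in 𝒯.elem T, ∑ i, polyEval (v.v0 T i) x * polyEval (MvPolynomial.pderiv i w) x)
      + ∑ e ∈ 𝒯.facesOf T, ∫ x in 𝒯.face e,
          inner ℝ (v.vb T e x) (polyEval w x • 𝒯.normal T e) ∂(surf d) := by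
  refine IsBilinOn.add (IsBilinOn.neg ?_) (IsBilinOn.sum fun e he => ?_)
  · refine IsBilinOn.setIntegral (fun _ _ _ _ => 𝒯.integrableOn_elem T (by fun_prop)) fun z => ?_
    exact IsBilinOn.sum fun i _ =>
      IsBilinOn.mul (WeakFn.isLinearOn_v0 _ T i z) ⟨by simp, by simp⟩
  · refine IsBilinOn.setIntegral (fun v hv w _ => 𝒯.integrableOn_face e ?_) fun z => ?_
    · have := MemW.continuousOn hv he
      exact this.inner (by fun_prop)
    · exact IsBilinOn.inner (fun _ _ _ _ => rfl) (fun _ _ _ => rfl)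
        (fun _ _ _ _ => by rw [polyEval_add, add_smul]) fun _ _ _ => by rw [polyEval_smul, mul_smul]

variable {𝒯} in
-- The right-hand side is a linear functional on a finite-dimensional polynomial space with definite
-- `L²` product, so it has a representative. Membership in `W_h` provides the integrability of the
-- boundary terms.
theorem MemW.isWeakDiv {k : ℕ} {v : WeakFn d ι κ} (hv : MemW 𝒯 k v) (r : ℕ) (T : ι) :
    IsWeakDiv 𝒯 r T v (weakDiv 𝒯 r T v) := by
  refine Classical.epsilon_spec (p := IsWeakDiv 𝒯 r T v) ?_
  obtain ⟨D, hD, h⟩ := (𝒯.isBilinOn_polyInner T (MvPolynomial.restrictTotalDegree (Fin d) ℝ r)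
    (MvPolynomial.restrictTotalDegree (Fin d) ℝ r)).exists_of_definite
    (fun D _ => 𝒯.polyInner_definite T) ((𝒯.isBilinOn_divFunctional k T _).2 v hv)
  exact ⟨D, (MvPolynomial.mem_restrictTotalDegree _ _ _).1 hD, fun w hw =>
    h w ((MvPolynomial.mem_restrictTotalDegree _ _ _).2 hw)⟩

theorem PolyMesh.weakDiv_linear (k r : ℕ) (T : ι) :
    (∀ u ∈ 𝒯.W k, ∀ v ∈ 𝒯.W k, weakDiv 𝒯 r T (u + v) = weakDiv 𝒯 r T u + weakDiv 𝒯 r T v) ∧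
    ∀ (c : ℝ), ∀ v ∈ 𝒯.W k, weakDiv 𝒯 r T (c • v) = c • weakDiv 𝒯 r T v :=
  (𝒯.isBilinOn_polyInner T (MvPolynomial.restrictTotalDegree (Fin d) ℝ r)
    (MvPolynomial.restrictTotalDegree (Fin d) ℝ r)).linear_of_represents
    (fun _ _ => 𝒯.polyInner_definite T) (𝒯.isBilinOn_divFunctional k T _)
    (fun _ hv => (MvPolynomial.mem_restrictTotalDegree _ _ _).2 (MemW.isWeakDiv hv r T).1)
    fun _ hv w hw => (MemW.isWeakDiv hv r T).2 w ((MvPolynomial.mem_restrictTotalDegree _ _ _).1 hw)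

/-! ### The discrete weak strain -/

/-- Symmetric matrices of polynomials of degree at most `r`. -/
def symmPoly (d r : ℕ) : Submodule ℝ (Matrix (Fin d) (Fin d) (MvPolynomial (Fin d) ℝ)) where
  carrier := {S | S.IsSymm ∧ ∀ i j, (S i j).totalDegree ≤ r}
  add_mem' h h' := ⟨h.1.add h'.1, fun i j => (MvPolynomial.totalDegree_add _ _).trans
    (max_le (h.2 i j) (h'.2 i j))⟩
  zero_mem' := ⟨Matrix.isSymm_zero, by simp⟩
  smul_mem' c _ h := ⟨h.1.smul c, fun i j =>
    (MvPolynomial.totalDegree_smul_le _ _).trans (h.2 i j)⟩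

instance finiteDimensional_symmPoly (r : ℕ) : FiniteDimensional ℝ (symmPoly d r) := by
  let f : symmPoly d r →ₗ[ℝ] Fin d → Fin d → MvPolynomial.restrictTotalDegree (Fin d) ℝ r :=
    { toFun := fun S i j => ⟨S.1 i j, (MvPolynomial.mem_restrictTotalDegree _ _ _).2 (S.2.2 i j)⟩
      map_add' := fun _ _ => rfl
      map_smul' := fun _ _ => rfl }
  refine FiniteDimensional.of_injective f fun S S' h => Subtype.ext ?_
  ext1 i j
  exact congrArg Subtype.val (congrFun (congrFun h i) j)

theorem PolyMesh.isBilinOn_strainFunctional (k : ℕ) (T : ι)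
    (p : Submodule ℝ (Matrix (Fin d) (Fin d) (MvPolynomial (Fin d) ℝ))) :
    IsBilinOn (𝒯.W k) p fun v w =>
      -(∫ x in 𝒯.elem T, ∑ i, polyEval (v.v0 T i) x *
            ∑ j, polyEval (MvPolynomial.pderiv j (w i j)) x)
        + ∑ e ∈ 𝒯.facesOf T, ∫ x in 𝒯.face e,
            ∑ i, v.vb T e x i * ∑ j, polyEval (w i j) x * 𝒯.normal T e j ∂(surf d) := by
  refine IsBilinOn.add (IsBilinOn.neg ?_) (IsBilinOn.sum fun e he => ?_)
  · refine IsBilinOn.setIntegral (fun _ _ _ _ => 𝒯.integrableOn_elem T (by fun_prop)) fun z => ?_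
    exact IsBilinOn.sum fun i _ =>
      IsBilinOn.mul (WeakFn.isLinearOn_v0 _ T i z) (IsLinearOn.sum fun j _ => ⟨by simp, by simp⟩)
  · refine IsBilinOn.setIntegral (fun v hv w _ => 𝒯.integrableOn_face e ?_) fun z => ?_
    · have := MemW.continuousOn hv he
      refine continuousOn_finsetSum _ fun i _ => ContinuousOn.mul ?_ (by fun_prop)
      exact (EuclideanSpace.proj (𝕜 := ℝ) i).continuous.comp_continuousOn this
    · refine IsBilinOn.sum fun i _ => IsBilinOn.mul (WeakFn.isLinearOn_vb _ T e i z)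
        (IsLinearOn.sum fun j _ => ⟨fun _ _ _ _ => by simp [add_mul], fun _ _ _ => by
          simp [mul_assoc]⟩)

variable {𝒯} in
theorem MemW.isWeakStrain {k : ℕ} {v : WeakFn d ι κ} (hv : MemW 𝒯 k v) (r : ℕ) (T : ι) :
    IsWeakStrain 𝒯 r T v (weakStrain 𝒯 r T v) := by
  refine Classical.epsilon_spec (p := IsWeakStrain 𝒯 r T v) ?_
  obtain ⟨S, hS, h⟩ := (𝒯.isBilinOn_strainInner T (symmPoly d r) (symmPoly d r)).exists_of_definite
    (fun D _ => 𝒯.strainInner_definite T) ((𝒯.isBilinOn_strainFunctional k T _).2 v hv)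
  exact ⟨S, hS.1, hS.2, fun w hw hw' => h w ⟨hw, hw'⟩⟩

theorem PolyMesh.weakStrain_linear (k r : ℕ) (T : ι) :
    (∀ u ∈ 𝒯.W k, ∀ v ∈ 𝒯.W k,
      weakStrain 𝒯 r T (u + v) = weakStrain 𝒯 r T u + weakStrain 𝒯 r T v) ∧
    ∀ (c : ℝ), ∀ v ∈ 𝒯.W k, weakStrain 𝒯 r T (c • v) = c • weakStrain 𝒯 r T v :=
  (𝒯.isBilinOn_strainInner T (symmPoly d r) (symmPoly d r)).linear_of_represents
    (fun _ _ => 𝒯.strainInner_definite T) (𝒯.isBilinOn_strainFunctional k T _)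
    (fun _ hv => ⟨(MemW.isWeakStrain hv r T).1, (MemW.isWeakStrain hv r T).2.1⟩)
    fun _ hv w hw => (MemW.isWeakStrain hv r T).2.2 w hw.1 hw.2

end Mesh

end WG
end

/-! ### Mesh incidence, definiteness and lifting of the data. -/

noncomputable section
namespace WG

variable {d N M : ℕ} {G : InterfaceGeometry d N M} {ι κ : Type*} (𝒯 : PolyMesh G ι κ)

/-! ### Incidence of faces, elements and subdomains -/

theorem PolyMesh.sub_unique {T : ι} {i j : Fin N} (hi : 𝒯.elem T ⊆ G.sub i)
    (hj : 𝒯.elem T ⊆ G.sub j) : i = j := by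
  by_contra h
  obtain ⟨x, hx⟩ := 𝒯.nonempty_elem T
  exact Set.disjoint_left.1 (G.sub_disjoint h) (hi hx) (hj hx)

theorem PolyMesh.elem_eq_of_mem {T T' : ι} {x : Pt d} (hx : x ∈ 𝒯.elem T)
    (hx' : x ∈ closure (𝒯.elem T')) : T = T' := by
  by_contra h
  obtain ⟨y, hy, hy'⟩ := mem_closure_iff.1 hx' _ (𝒯.isOpen_elem T) hx
  exact Set.disjoint_left.1 (𝒯.elem_disjoint h) hy hy'

theorem PolyMesh.diam_pos [Nonempty (Fin d)] (T : ι) : 0 < Metric.diam (𝒯.elem T) := by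
  obtain ⟨x, hx⟩ := 𝒯.nonempty_elem T
  have hinf : (𝒯.elem T).Infinite := infinite_of_mem_nhds x ((𝒯.isOpen_elem T).mem_nhds hx)
  exact Metric.diam_pos hinf.nontrivial (𝒯.isBounded_elem T)

variable [Fintype κ]

section Incidence

variable {𝒯}

theorem PolyMesh.not_boundary_of_ne {T T' : ι} {e : κ} (hT : e ∈ 𝒯.facesOf T)
    (hT' : e ∈ 𝒯.facesOf T') (h : T ≠ T') : ¬ 𝒯.face e ⊆ frontier G.Ω := fun hb =>
  h ((𝒯.boundary_face e hb).unique (𝒯.mem_facesOf.1 hT) (𝒯.mem_facesOf.1 hT'))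

theorem PolyMesh.eq_or_eq {T T' S : ι} {e : κ} (hT : e ∈ 𝒯.facesOf T)
    (hT' : e ∈ 𝒯.facesOf T') (h : T ≠ T') (hS : e ∈ 𝒯.facesOf S) : S = T ∨ S = T' := by
  obtain ⟨A, B, -, hAB⟩ := 𝒯.interior_face e (PolyMesh.not_boundary_of_ne hT hT' h)
  have h1 := (hAB T).1 (𝒯.mem_facesOf.1 hT)
  have h2 := (hAB T').1 (𝒯.mem_facesOf.1 hT')
  have h3 := (hAB S).1 (𝒯.mem_facesOf.1 hS)
  grind

/-- Both normals are unit vectors orthogonal to the same hyperplane, so they agree up to sign. Equal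
normals would put the points just behind the face into both disjoint elements. -/
theorem PolyMesh.normal_eq_neg {T T' : ι} {e : κ} (hT : e ∈ 𝒯.facesOf T)
    (hT' : e ∈ 𝒯.facesOf T') (h : T ≠ T') : 𝒯.normal T' e = -𝒯.normal T e := by
  have hn := PolyMesh.isUnitNormal hT
  have hn' := PolyMesh.isUnitNormal hT'
  have hmem : 𝒯.normal T' e ∈ (ℝ ∙ 𝒯.normal T e)ᗮᗮ := by
    rw [← (𝒯.face_flat e).vectorSpan_eq hn, Submodule.mem_orthogonal']
    exact hn'.orthogonal
  rw [Submodule.orthogonal_orthogonal] at hmem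
  obtain ⟨c, hc⟩ := Submodule.mem_span_singleton.1 hmem
  have hc1 : |c| = 1 := by
    have := congrArg norm hc
    rwa [norm_smul, hn.norm_eq_one, hn'.norm_eq_one, mul_one, Real.norm_eq_abs] at this
  rcases eq_or_eq_neg_of_abs_eq hc1 with rfl | rfl
  · exfalso
    rw [one_smul] at hc
    obtain ⟨x, hx⟩ := (𝒯.face_flat e).relint_nonempty
    obtain ⟨δ, hδ, h1⟩ := (𝒯.normal_spec T e (𝒯.mem_facesOf.1 hT)).outward x hx
    obtain ⟨δ', hδ', h2⟩ := (𝒯.normal_spec T' e (𝒯.mem_facesOf.1 hT')).outward x hx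
    obtain ⟨t, ht0, ht⟩ := exists_between (lt_min hδ hδ')
    have m1 := (h1 t ht0 (ht.trans_le (min_le_left _ _))).1
    have m2 := (h2 t ht0 (ht.trans_le (min_le_right _ _))).1
    rw [← hc] at m2
    exact Set.disjoint_left.1 (𝒯.elem_disjoint h) m1 m2
  · rw [← hc, neg_one_smul]

theorem PolyMesh.IsInterfaceFace.ne {m : Fin M} {e : κ} {T T' : ι}
    (h : 𝒯.IsInterfaceFace m e T T') : T ≠ T' := by
  rintro rfl
  exact G.left_ne_right m (𝒯.sub_unique h.2.2.2.1 h.2.2.2.2)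

/-- At most two elements share the face, so only a swap of sides could spoil uniqueness. A swap
gives the same unordered pair of subdomains, hence `m = m'`, and then left and right coincide. This
makes the lifted jump datum unambiguous. -/
theorem PolyMesh.IsInterfaceFace.unique {m m' : Fin M} {e : κ} {T T' S S' : ι}
    (h : 𝒯.IsInterfaceFace m e T T') (h' : 𝒯.IsInterfaceFace m' e S S') :
    m = m' ∧ T = S ∧ T' = S' := by
  obtain ⟨-, hT, hT', hl, hr⟩ := id h
  obtain ⟨-, hS, hS', hl', hr'⟩ := id h'
  have hne' := h'.ne
  rcases PolyMesh.eq_or_eq hT hT' h.ne hS with rfl | rfl <;>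
    rcases PolyMesh.eq_or_eq hT hT' h.ne hS' with rfl | rfl
  · exact absurd rfl hne'
  · refine ⟨G.pair_injective ?_, rfl, rfl⟩
    simp only
    rw [𝒯.sub_unique hl hl', 𝒯.sub_unique hr hr']
  · exfalso
    have e1 := 𝒯.sub_unique hl hr'
    have e2 := 𝒯.sub_unique hr hl'
    have : m = m' := G.pair_injective (by simp only; rw [e1, e2, Sym2.eq_swap])
    subst this
    exact G.left_ne_right m e1
  · exact absurd rfl hne'

theorem PolyMesh.face_subset_closure {T : ι} {e : κ} (hT : e ∈ 𝒯.facesOf T) {i : Fin N}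
    (hi : 𝒯.elem T ⊆ G.sub i) : 𝒯.face e ⊆ closure (G.sub i) := fun _ hx =>
  closure_mono hi (frontier_subset_closure (𝒯.mem_facesOf.1 hT hx))

theorem PolyMesh.face_subset_frontier {T T' : ι} {e : κ} (hT : e ∈ 𝒯.facesOf T)
    (hT' : e ∈ 𝒯.facesOf T') {i j : Fin N} (hi : 𝒯.elem T ⊆ G.sub i) (hj : 𝒯.elem T' ⊆ G.sub j)
    (hij : i ≠ j) : 𝒯.face e ⊆ frontier (G.sub i) := by
  intro x hx
  rw [(G.isOpen_sub i).frontier_eq]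
  refine ⟨PolyMesh.face_subset_closure hT hi hx, fun hxi => ?_⟩
  obtain ⟨y, hy, hy'⟩ := mem_closure_iff.1 (PolyMesh.face_subset_closure hT' hj hx) _
    (G.isOpen_sub i) hxi
  exact Set.disjoint_left.1 (G.sub_disjoint hij) hy hy'

/-- A face between two different subdomains lies on one of the interface pieces. -/
theorem PolyMesh.exists_isInterfaceFace {T T' : ι} {e : κ} (hT : e ∈ 𝒯.facesOf T)
    (hT' : e ∈ 𝒯.facesOf T') {i j : Fin N} (hi : 𝒯.elem T ⊆ G.sub i) (hj : 𝒯.elem T' ⊆ G.sub j)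
    (hij : i ≠ j) : ∃ m, 𝒯.IsInterfaceFace m e T T' ∨ 𝒯.IsInterfaceFace m e T' T := by
  have hne : T ≠ T' := by
    rintro rfl
    exact hij (𝒯.sub_unique hi hj)
  have hfi := PolyMesh.face_subset_frontier hT hT' hi hj hij
  have hfj := PolyMesh.face_subset_frontier hT' hT hj hi hij.symm
  obtain ⟨y, hye, hyΩ⟩ := not_subset.1 (PolyMesh.not_boundary_of_ne hT hT' hne)
  have hpos := (𝒯.face_flat e).surf_inter_pos (PolyMesh.isUnitNormal hT)
    isClosed_frontier.isOpen_compl ⟨y, hye, hyΩ⟩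
  have hnull : surf d (⋃ e', 𝒯.face e' \ intrinsicInterior ℝ (𝒯.face e')) = 0 := by
    refine measure_iUnion_null fun e' => ?_
    obtain ⟨n, hn⟩ := 𝒯.exists_isUnitNormal e'
    exact (𝒯.face_flat e').surf_relBdry hn
  -- The part of `e` off `∂Ω` has positive surface measure, while the relative boundaries of all
  -- faces are null. The point `x` therefore lies in the relative interior of every face through it.
  obtain ⟨x, ⟨hxe, hxΩ⟩, hxN⟩ : ∃ x ∈ 𝒯.face e ∩ (frontier G.Ω)ᶜ,
      x ∉ ⋃ e', 𝒯.face e' \ intrinsicInterior ℝ (𝒯.face e') := by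
    by_contra! hall
    exact hpos.ne' (measure_mono_null hall hnull)
  have hrel : ∀ e', x ∈ 𝒯.face e' → x ∈ intrinsicInterior ℝ (𝒯.face e') := by
    intro e' hx'
    by_contra hx''
    exact hxN (mem_iUnion.2 ⟨e', hx', hx''⟩)
  have hxT : x ∈ frontier (𝒯.elem T) := 𝒯.mem_facesOf.1 hT hxe
  -- An element of subdomain `l` with `x` in its closure has `x` on one of its faces. By genericity
  -- and disjoint relative interiors this face is `e`, so the element is `T` or `T'`.
  have key : ∀ l, x ∈ frontier (G.sub l) → l = i ∨ l = j := by
    intro l hl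
    have hcl := frontier_subset_closure hl
    rw [𝒯.closure_sub l] at hcl
    obtain ⟨S, hS, hxS⟩ := mem_iUnion₂.1 hcl
    have hxS' : x ∉ 𝒯.elem S := by
      intro hmem
      obtain rfl := 𝒯.elem_eq_of_mem hmem (frontier_subset_closure hxT)
      rw [(𝒯.isOpen_elem S).frontier_eq] at hxT
      exact hxT.2 hmem
    have hxfr : x ∈ frontier (𝒯.elem S) := by
      rw [(𝒯.isOpen_elem S).frontier_eq]; exact ⟨hxS, hxS'⟩
    have hxfr' := hxfr
    rw [𝒯.frontier_elem S] at hxfr'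
    obtain ⟨e', he', hxe'⟩ := mem_iUnion₂.1 hxfr'
    have hee : e' = e := by
      by_contra hee
      exact Set.disjoint_left.1 (𝒯.face_disjoint hee) (hrel e' hxe') (hrel e hxe)
    subst hee
    rcases PolyMesh.eq_or_eq hT hT' hne (𝒯.mem_facesOf.2 he') with rfl | rfl
    · exact Or.inl (𝒯.sub_unique hS hi)
    · exact Or.inr (𝒯.sub_unique hS hj)
  -- Some interface piece passes through `x`; by `key` its two subdomains can only be `i` and `j`.
  -- The single point thus determines the piece for the entire face.
  have hxI : x ∈ (⋃ i, frontier (G.sub i)) \ frontier G.Ω :=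
    ⟨mem_iUnion.2 ⟨i, hfi hxe⟩, hxΩ⟩
  rw [G.interface_eq] at hxI
  obtain ⟨m, hl, hr⟩ := mem_iUnion.1 hxI.1
  have hlr := G.left_ne_right m
  refine ⟨m, ?_⟩
  rcases key _ hl with h1 | h1 <;> rcases key _ hr with h2 | h2
  · exact absurd (h1.trans h2.symm) hlr
  · refine Or.inl ⟨fun z hz => ?_, hT, hT', by rwa [h1], by rwa [h2]⟩
    rw [InterfaceGeometry.Γ, h1, h2]
    exact ⟨hfi hz, hfj hz⟩
  · refine Or.inr ⟨fun z hz => ?_, hT', hT, by rwa [h1], by rwa [h2]⟩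
    rw [InterfaceGeometry.Γ, h1, h2]
    exact ⟨hfj hz, hfi hz⟩
  · exact absurd (h1.trans h2.symm) hlr

end Incidence

/-- A set of elements that have no face on `∂Ω` and that is closed under passing to a neighbour is
empty. -/
theorem PolyMesh.eq_empty_of_closed [Nonempty (Fin d)] {A : Finset ι}
    (hb : ∀ T ∈ A, ∀ e ∈ 𝒯.facesOf T, ¬ 𝒯.face e ⊆ frontier G.Ω)
    (hA : ∀ T ∈ A, ∀ e ∈ 𝒯.facesOf T, ∀ T', e ∈ 𝒯.facesOf T' → T' ∈ A) : A = ∅ := by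
  classical
  obtain ⟨j⟩ := ‹Nonempty (Fin d)›
  -- The volume is the flux of the field `x_j e_j`, whose divergence is one.
  have hvol : ∀ T, volume.real (𝒯.elem T) =
      ∑ e ∈ 𝒯.facesOf T, 𝒯.normal T e j *
        ∫ x in 𝒯.face e, polyEval (MvPolynomial.X j) x ∂(surf d) := by
    intro T
    rw [← 𝒯.setIntegral_pderiv T (MvPolynomial.X j) j]
    simp [polyEval]
  have hpos : ∀ T, 0 < volume.real (𝒯.elem T) := fun T =>
    ENNReal.toReal_pos ((𝒯.isOpen_elem T).measure_pos _ (𝒯.nonempty_elem T)).ne'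
      (𝒯.isBounded_elem T).measure_lt_top.ne
  have hsum : ∑ T ∈ A, volume.real (𝒯.elem T) = 0 := by
    have hswap : ∑ T ∈ A, volume.real (𝒯.elem T) = ∑ e, ∑ T ∈ A with e ∈ 𝒯.facesOf T,
        𝒯.normal T e j * ∫ x in 𝒯.face e, polyEval (MvPolynomial.X j) x ∂(surf d) := by
      simp_rw [hvol]
      exact Finset.sum_comm' (by simp [and_comm])
    rw [hswap]
    refine Finset.sum_eq_zero fun e _ => ?_
    rcases (A.filter fun T => e ∈ 𝒯.facesOf T).eq_empty_or_nonempty with h | ⟨S, hS⟩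
    · rw [h, Finset.sum_empty]
    · obtain ⟨hSA, hSe⟩ := Finset.mem_filter.1 hS
      obtain ⟨T, T', hne, hTT⟩ := 𝒯.interior_face e (hb S hSA e hSe)
      have hT : e ∈ 𝒯.facesOf T := 𝒯.mem_facesOf.2 ((hTT T).2 (Or.inl rfl))
      have hT' : e ∈ 𝒯.facesOf T' := 𝒯.mem_facesOf.2 ((hTT T').2 (Or.inr rfl))
      -- Closure under neighbours puts both elements at the face into `A`, so their opposite normals
      -- cancel.
      have hfil : (A.filter fun T => e ∈ 𝒯.facesOf T) = {T, T'} := by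
        ext R
        simp only [Finset.mem_filter, Finset.mem_insert, Finset.mem_singleton]
        constructor
        · exact fun h => (hTT R).1 (𝒯.mem_facesOf.1 h.2)
        · rintro (rfl | rfl)
          · exact ⟨hA S hSA e hSe _ hT, hT⟩
          · exact ⟨hA S hSA e hSe _ hT', hT'⟩
      rw [hfil, Finset.sum_pair hne, PolyMesh.normal_eq_neg hT hT' hne]
      simp
  by_contra hne
  exact (Finset.sum_pos (fun T _ => hpos T) (Finset.nonempty_iff_ne_empty.2 hne)).ne' hsum

/-! ### The boundary defect -/

theorem bdryDefect_add (k : ℕ) (u v : WeakFn d ι κ) (T : ι) (e : κ) (x : Pt d) :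
    bdryDefect 𝒯 k (u + v) T e x = bdryDefect 𝒯 k u T e x + bdryDefect 𝒯 k v T e x := by
  obtain ⟨n, hn⟩ := 𝒯.exists_isUnitNormal e
  have hle := (𝒯.face_flat e).continuousFields_le hn
  have h := ((𝒯.face_flat e).faceProj_linear (k := k) hn).1
    (polyVec (u.v0 T)) (hle (continuous_polyVec _).continuousOn)
    (polyVec (v.v0 T)) (hle (continuous_polyVec _).continuousOn)
  have h' : polyVec ((u + v).v0 T) = polyVec (u.v0 T) + polyVec (v.v0 T) := by
    funext x; exact polyVec_add _ _ x
  rw [bdryDefect, h', h]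
  simp only [bdryDefect, Pi.add_apply, WeakFn.vb_add]
  abel

theorem bdryDefect_smul (k : ℕ) (c : ℝ) (v : WeakFn d ι κ) (T : ι) (e : κ) (x : Pt d) :
    bdryDefect 𝒯 k (c • v) T e x = c • bdryDefect 𝒯 k v T e x := by
  obtain ⟨n, hn⟩ := 𝒯.exists_isUnitNormal e
  have hle := (𝒯.face_flat e).continuousFields_le hn
  have h := ((𝒯.face_flat e).faceProj_linear (k := k) hn).2 c
    (polyVec (v.v0 T)) (hle (continuous_polyVec _).continuousOn)
  have h' : polyVec ((c • v).v0 T) = c • polyVec (v.v0 T) := by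
    funext x; exact polyVec_smul _ _ x
  rw [bdryDefect, h', h]
  simp only [bdryDefect, Pi.smul_apply, WeakFn.vb_smul, smul_sub]

variable {𝒯} in
theorem isFaceProj_polyVec {k : ℕ} (v : WeakFn d ι κ) (T : ι) (e : κ) :
    IsFaceProj k (𝒯.face e) (polyVec (v.v0 T)) (faceProj k (𝒯.face e) (polyVec (v.v0 T))) := by
  obtain ⟨n, hn⟩ := 𝒯.exists_isUnitNormal e
  exact (𝒯.face_flat e).isFaceProj_faceProj hn
    ((𝒯.face_flat e).continuousFields_le hn (continuous_polyVec _).continuousOn)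

variable {𝒯} in
theorem MemW.bdryDefect_mem {k : ℕ} {v : WeakFn d ι κ} (hv : MemW 𝒯 k v) {T : ι} {e : κ}
    (he : e ∈ 𝒯.facesOf T) : bdryDefect 𝒯 k v T e ∈ faceSpace k (𝒯.face e) :=
  (faceSubmodule k (𝒯.face e)).sub_mem (isFaceProj_polyVec v T e).1 (hv.mem_faceSpace T e he)

/-! ### Vanishing discrete weak strain -/

/-- If the discrete weak strain vanishes and the boundary values are the projections of the interior
values, then the symmetric gradient of the interior values vanishes. -/
theorem MemW.symmGrad_eq_zero {𝒯 : PolyMesh G ι κ} {k : ℕ} {v : WeakFn d ι κ} (hv : MemW 𝒯 k v)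
    (T : ι)
    (hb : ∀ e ∈ 𝒯.facesOf T, v.vb T e = faceProj k (𝒯.face e) (polyVec (v.v0 T)))
    (hs : weakStrain 𝒯 (k - 1) T v = 0) (i j : Fin d) :
    MvPolynomial.pderiv j (v.v0 T i) + MvPolynomial.pderiv i (v.v0 T j) = 0 := by
  set u := v.v0 T with hu
  -- The test matrix is twice the symmetric gradient, which has the degree allowed for the weak
  -- strain.
  set w : Matrix (Fin d) (Fin d) (MvPolynomial (Fin d) ℝ) :=
    fun i j => MvPolynomial.pderiv j (u i) + MvPolynomial.pderiv i (u j) with hw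
  have hwsymm : w.IsSymm := by
    ext1 i j
    simp only [hw]
    exact add_comm _ _
  have hwdeg : ∀ i j, (w i j).totalDegree ≤ k - 1 := fun i j =>
    (MvPolynomial.totalDegree_add _ _).trans (max_le
      (totalDegree_pderiv_le (hv.degree_le T i) j) (totalDegree_pderiv_le (hv.degree_le T j) i))
  have hbdry : ∀ e ∈ 𝒯.facesOf T, ∫ x in 𝒯.face e,
      ∑ i, v.vb T e x i * ∑ j, polyEval (w i j) x * 𝒯.normal T e j ∂(surf d) =
      ∑ i, ∑ j, 𝒯.normal T e j * ∫ x in 𝒯.face e, polyEval (u i * w i j) x ∂(surf d) := by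
    intro e he
    set q : Fin d → MvPolynomial (Fin d) ℝ :=
      fun i => ∑ j, w i j * MvPolynomial.C (𝒯.normal T e j) with hq
    -- The normal is constant on the face, so `w n` is a polynomial field of degree at most `k - 1`
    -- and belongs to `S_k`. Tested against it, `Q_b v_0` may be replaced by `v_0`.
    have hqmem : (𝒯.face e).indicator (polyVec q) ∈ faceSpace k (𝒯.face e) := by
      refine ⟨q, 0, 0, fun i => ?_, by simp, ?_⟩
      · refine MvPolynomial.totalDegree_finsetSum_le fun j _ =>
          (MvPolynomial.totalDegree_mul _ _).trans ?_
        simpa using hwdeg i j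
      · congr 1
        funext x
        ext i
        simp [rigidMotion]
    have hproj := (isFaceProj_polyVec (𝒯 := 𝒯) (k := k) v T e).2 _ hqmem
    rw [← hb e he] at hproj
    have hm := (𝒯.face_flat e).isCompact.measurableSet
    have e1 : ∫ x in 𝒯.face e, ∑ i, v.vb T e x i * ∑ j, polyEval (w i j) x * 𝒯.normal T e j
        ∂(surf d) = ∫ x in 𝒯.face e,
          inner ℝ (v.vb T e x) ((𝒯.face e).indicator (polyVec q) x) ∂(surf d) :=
      setIntegral_congr_fun hm fun x hx => by
        simp only [indicator_of_mem hx, PiLp.inner_apply, polyVec_apply, hq, polyEval_sum,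
          polyEval_mul, polyEval_C, RCLike.inner_apply, conj_trivial]
        exact Finset.sum_congr rfl fun i _ => mul_comm _ _
    have e2 : ∫ x in 𝒯.face e,
          inner ℝ (polyVec (v.v0 T) x) ((𝒯.face e).indicator (polyVec q) x) ∂(surf d) =
        ∫ x in 𝒯.face e, ∑ i, ∑ j, 𝒯.normal T e j * polyEval (u i * w i j) x ∂(surf d) :=
      setIntegral_congr_fun hm fun x hx => by
        simp only [indicator_of_mem hx, PiLp.inner_apply, polyVec_apply, hq, polyEval_sum,
          polyEval_mul, polyEval_C, RCLike.inner_apply, conj_trivial, Finset.sum_mul]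
        exact Finset.sum_congr rfl fun i _ => Finset.sum_congr rfl fun j _ => by ring
    rw [e1, hproj, e2, integral_finsetSum _ fun i _ => 𝒯.integrableOn_face e
      (Continuous.continuousOn (by fun_prop))]
    refine Finset.sum_congr rfl fun i _ => ?_
    rw [integral_finsetSum _ fun j _ => 𝒯.integrableOn_face e
      (Continuous.continuousOn (by fun_prop))]
    exact Finset.sum_congr rfl fun j _ => integral_const_mul _ _
  have hdiv : ∑ e ∈ 𝒯.facesOf T, ∫ x in 𝒯.face e,
      ∑ i, v.vb T e x i * ∑ j, polyEval (w i j) x * 𝒯.normal T e j ∂(surf d) =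
      ∫ x in 𝒯.elem T, ∑ i, ∑ j, polyEval (MvPolynomial.pderiv j (u i * w i j)) x := by
    rw [Finset.sum_congr rfl hbdry, Finset.sum_comm,
      integral_finsetSum _ fun i _ => 𝒯.integrableOn_elem T (by fun_prop)]
    refine Finset.sum_congr rfl fun i _ => ?_
    rw [Finset.sum_comm, integral_finsetSum _ fun j _ => 𝒯.integrableOn_elem T (by fun_prop)]
    exact Finset.sum_congr rfl fun j _ => (𝒯.setIntegral_pderiv T _ j).symm
  have heq := (MemW.isWeakStrain hv (k - 1) T).2.2 w hwsymm hwdeg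
  rw [hs, hdiv, ← sub_eq_neg_add, ← integral_sub (𝒯.integrableOn_elem T (by fun_prop))
    (𝒯.integrableOn_elem T (by fun_prop))] at heq
  simp only [Matrix.zero_apply, polyEval_zero, zero_mul, Finset.sum_const_zero,
    integral_zero] at heq
  -- What remains of the defining identity after the product rule is `∫ ∇u : w = 0`. Symmetry of `w`
  -- gives `2 ∇u : w = w : w`.
  have hzero : ∫ x in 𝒯.elem T, ∑ i, ∑ j, polyEval (w i j) x * polyEval (w i j) x = 0 := by
    rw [← mul_zero (2 : ℝ), heq, ← integral_const_mul]
    congr 1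
    funext x
    have h1 : ∑ i, ∑ j, polyEval (MvPolynomial.pderiv j (u i * w i j)) x -
        ∑ i, polyEval (u i) x * ∑ j, polyEval (MvPolynomial.pderiv j (w i j)) x =
        ∑ i, ∑ j, polyEval (MvPolynomial.pderiv j (u i)) x * polyEval (w i j) x := by
      rw [← Finset.sum_sub_distrib]
      refine Finset.sum_congr rfl fun i _ => ?_
      rw [Finset.mul_sum, ← Finset.sum_sub_distrib]
      refine Finset.sum_congr rfl fun j _ => ?_
      rw [MvPolynomial.pderiv_mul]
      simp
    have h2 : ∑ i, ∑ j, polyEval (MvPolynomial.pderiv i (u j)) x * polyEval (w i j) x =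
        ∑ i, ∑ j, polyEval (MvPolynomial.pderiv j (u i)) x * polyEval (w i j) x := by
      rw [Finset.sum_comm]
      refine Finset.sum_congr rfl fun i _ => Finset.sum_congr rfl fun j _ => ?_
      rw [hwsymm.apply]
    rw [h1, two_mul]
    nth_rewrite 2 [← h2]
    simp only [← Finset.sum_add_distrib, ← add_mul]
    exact Finset.sum_congr rfl fun i _ => Finset.sum_congr rfl fun j _ => by
      simp [hw]
  exact congrFun (congrFun (𝒯.strainInner_definite T hzero) i) j

/-! ### Lifting of the boundary and jump data -/

open Classical in
/-- A weak function with prescribed boundary values and jumps. -/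
def PolyMesh.lift (k : ℕ) (g : Pt d → Pt d) (φ : Fin M → Pt d → Pt d) : WeakFn d ι κ where
  v0 := 0
  vb T e :=
    if e ∈ 𝒯.facesOf T then
      if 𝒯.face e ⊆ frontier G.Ω then faceProj k (𝒯.face e) g
      -- The whole jump is placed on the left side and zero on the right; `h.choose` is the true
      -- index because interface faces determine their piece.
      else if h : ∃ m T', 𝒯.IsInterfaceFace m e T T' then faceProj k (𝒯.face e) (φ h.choose)
      else 0
    else 0

section Lift

variable {k : ℕ} {g : Pt d → Pt d} {φ : Fin M → Pt d → Pt d}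

theorem PolyMesh.lift_boundary {T : ι} {e : κ} (he : e ∈ 𝒯.facesOf T)
    (hb : 𝒯.face e ⊆ frontier G.Ω) : (𝒯.lift k g φ).vb T e = faceProj k (𝒯.face e) g := by
  simp [PolyMesh.lift, he, hb]

variable {𝒯} in
theorem PolyMesh.IsInterfaceFace.lift_left {m : Fin M} {e : κ} {T T' : ι}
    (h : 𝒯.IsInterfaceFace m e T T') :
    (𝒯.lift k g φ).vb T e = faceProj k (𝒯.face e) (φ m) := by
  have hex : ∃ m T', 𝒯.IsInterfaceFace m e T T' := ⟨m, T', h⟩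
  obtain ⟨S, hS⟩ := hex.choose_spec
  have hm : hex.choose = m := (hS.unique h).1
  simp only [PolyMesh.lift, if_pos h.2.1,
    if_neg (PolyMesh.not_boundary_of_ne h.2.1 h.2.2.1 h.ne), dif_pos hex]
  rw [hm]

theorem PolyMesh.lift_eq_zero {e : κ} {T : ι} (hb : ¬ 𝒯.face e ⊆ frontier G.Ω)
    (h : ¬ ∃ m T', 𝒯.IsInterfaceFace m e T T') : (𝒯.lift k g φ).vb T e = 0 := by
  simp only [PolyMesh.lift, if_neg hb, dif_neg h, ite_self]

theorem PolyMesh.lift_memW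
    (hg : ∀ e, 𝒯.face e ⊆ frontier G.Ω → IntegrableOn g (𝒯.face e) (surf d))
    (hφ : ∀ m e, 𝒯.face e ⊆ G.Γ m → IntegrableOn (φ m) (𝒯.face e) (surf d)) :
    MemW 𝒯 k (𝒯.lift k g φ) where
  degree_le T i := by simp [PolyMesh.lift]
  mem_faceSpace T e he := by
    by_cases hb : 𝒯.face e ⊆ frontier G.Ω
    · rw [𝒯.lift_boundary he hb]
      exact ((𝒯.face_flat e).isFaceProj_faceProj (PolyMesh.isUnitNormal he) (hg e hb)).1
    · by_cases h : ∃ m T', 𝒯.IsInterfaceFace m e T T'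
      · obtain ⟨m, T', hm⟩ := h
        rw [hm.lift_left]
        exact ((𝒯.face_flat e).isFaceProj_faceProj (PolyMesh.isUnitNormal he) (hφ m e hm.1)).1
      · rw [𝒯.lift_eq_zero hb h]
        exact (faceSubmodule k (𝒯.face e)).zero_mem
  eq_zero T e he := by simp [PolyMesh.lift, he]
  single_valued e T T' i hT hT' hi hi' := by
    by_cases hne : T = T'
    · rw [hne]
    have hb := PolyMesh.not_boundary_of_ne hT hT' hne
    -- If both elements at a face lie in one subdomain, the face is not an interface face: the
    -- right-hand element would be the second of the two, forcing left and right subdomains to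
    -- agree.
    have key : ∀ S S', e ∈ 𝒯.facesOf S → e ∈ 𝒯.facesOf S' → S ≠ S' → 𝒯.elem S ⊆ G.sub i →
        𝒯.elem S' ⊆ G.sub i → ¬ ∃ m R, 𝒯.IsInterfaceFace m e S R := by
      rintro S S' hS hS' hSS hi hi' ⟨m, R, h⟩
      rcases PolyMesh.eq_or_eq hS hS' hSS h.2.2.1 with rfl | rfl
      · exact h.ne rfl
      · exact G.left_ne_right m ((𝒯.sub_unique h.2.2.2.1 hi).trans
          (𝒯.sub_unique hi' h.2.2.2.2))
    rw [𝒯.lift_eq_zero hb (key T T' hT hT' hne hi hi'),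
      𝒯.lift_eq_zero hb (key T' T hT' hT (Ne.symm hne) hi' hi)]

variable {𝒯} in
theorem PolyMesh.IsInterfaceFace.lift_jump {m : Fin M} {e : κ} {T T' : ι}
    (h : 𝒯.IsInterfaceFace m e T T') :
    (𝒯.lift k g φ).vb T e - (𝒯.lift k g φ).vb T' e = faceProj k (𝒯.face e) (φ m) := by
  rw [h.lift_left, 𝒯.lift_eq_zero (PolyMesh.not_boundary_of_ne h.2.1 h.2.2.1 h.ne), sub_zero]
  rintro ⟨m', S, h'⟩
  exact h.ne (h.unique h').2.1

end Lift

theorem integrableOn_of_memLp_two {μ : Measure (Pt d)} {A B : Set (Pt d)} (hAB : A ⊆ B)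
    (hA : μ A < ⊤) {g : Pt d → Pt d} (hg : MemLp g 2 (μ.restrict B)) : IntegrableOn g A μ := by
  have : IsFiniteMeasure (μ.restrict A) := ⟨by simpa using hA⟩
  exact (hg.mono_measure (Measure.restrict_mono hAB le_rfl)).integrable one_le_two

theorem PolyMesh.integrableOn_face_of_memLp {e : κ} {B : Set (Pt d)} (he : 𝒯.face e ⊆ B)
    {g : Pt d → Pt d} (hg : MemLp g 2 ((surf d).restrict B)) :
    IntegrableOn g (𝒯.face e) (surf d) := by
  obtain ⟨n, hn⟩ := 𝒯.exists_isUnitNormal e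
  exact integrableOn_of_memLp_two he ((𝒯.face_flat e).surf_lt_top hn) hg

/-- The difference of two weak functions with the same boundary values and jumps lies in `W_h^0`. -/
theorem PolyMesh.sub_memW0 {k : ℕ} {g : Pt d → Pt d} {φ : Fin M → Pt d → Pt d}
    {u u' : WeakFn d ι κ} (hu : MemW 𝒯 k u) (hu' : MemW 𝒯 k u')
    (hb : ∀ T, ∀ e ∈ 𝒯.facesOf T, 𝒯.face e ⊆ frontier G.Ω → u.vb T e = faceProj k (𝒯.face e) g)
    (hb' : ∀ T, ∀ e ∈ 𝒯.facesOf T, 𝒯.face e ⊆ frontier G.Ω →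
      u'.vb T e = faceProj k (𝒯.face e) g)
    (hj : ∀ m e T T', 𝒯.IsInterfaceFace m e T T' →
      u.vb T e - u.vb T' e = faceProj k (𝒯.face e) (φ m))
    (hj' : ∀ m e T T', 𝒯.IsInterfaceFace m e T T' →
      u'.vb T e - u'.vb T' e = faceProj k (𝒯.face e) (φ m)) : MemW0 𝒯 k (u - u') := by
  have hW : MemW 𝒯 k (u - u') := (𝒯.W k).sub_mem hu hu'
  refine ⟨hW, fun T e he hbd => ?_, fun e T T' hT hT' => ?_⟩
  · simp [hb T e he hbd, hb' T e he hbd]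
  · obtain ⟨i, hi⟩ := 𝒯.elem_aligned T
    obtain ⟨j, hj0⟩ := 𝒯.elem_aligned T'
    by_cases hij : i = j
    · subst hij
      exact hW.single_valued e T T' i hT hT' hi hj0
    -- Equal prescribed jumps cancel in the difference; the two cases are the two orientations of
    -- the interface piece.
    · obtain ⟨m, hm | hm⟩ := PolyMesh.exists_isInterfaceFace hT hT' hi hj0 hij
      · have := (hj m e T T' hm).trans (hj' m e T T' hm).symm
        simp only [WeakFn.vb_sub, Pi.sub_apply]
        rw [sub_eq_sub_iff_sub_eq_sub]
        exact this
      · have := (hj m e T' T hm).trans (hj' m e T' T hm).symm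
        simp only [WeakFn.vb_sub, Pi.sub_apply]
        symm
        rw [sub_eq_sub_iff_sub_eq_sub]
        exact this

/-! ### The bilinear forms and the load -/

variable [Fintype ι]

theorem PolyMesh.isBilinOn_stab (k : ℕ) : IsBilinOn (𝒯.W k) (𝒯.W k) (stab 𝒯 k) := by
  refine IsBilinOn.sum fun T _ => IsBilinOn.const_mul (IsBilinOn.sum fun e he => ?_) _
  refine IsBilinOn.setIntegral (fun u hu v hv => 𝒯.integrableOn_face e ?_) fun z => ?_
  · exact (continuousOn_of_mem_faceSpace (MemW.bdryDefect_mem hu he)).inner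
      (continuousOn_of_mem_faceSpace (MemW.bdryDefect_mem hv he))
  · exact IsBilinOn.inner (fun u _ v _ => bdryDefect_add 𝒯 k u v T e z)
      (fun c v _ => bdryDefect_smul 𝒯 k c v T e z) (fun u _ v _ => bdryDefect_add 𝒯 k u v T e z)
      (fun c v _ => bdryDefect_smul 𝒯 k c v T e z)

theorem PolyMesh.isBilinOn_elasticForm (k : ℕ) {mu lam : Pt d → ℝ}
    (hmu : ∀ T, IntegrableOn mu (𝒯.elem T)) (hlam : ∀ T, IntegrableOn lam (𝒯.elem T)) :
    IsBilinOn (𝒯.W k) (𝒯.W k) (elasticForm 𝒯 k mu lam) := by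
  refine IsBilinOn.sum fun T _ => IsBilinOn.add ?_ ?_
  · refine IsBilinOn.setIntegral (fun u _ v _ =>
      𝒯.integrableOn_elem_mul T ((hmu T).const_mul 2) (by fun_prop)) fun z => ?_
    refine IsBilinOn.const_mul (IsBilinOn.sum fun i _ => IsBilinOn.sum fun j _ => ?_) _
    have h : IsLinearOn (𝒯.W k) fun v => polyEval (weakStrain 𝒯 (k - 1) T v i j) z :=
      ⟨fun u hu v hv => by
          rw [(𝒯.weakStrain_linear k (k - 1) T).1 u hu v hv, Matrix.add_apply, polyEval_add],
        fun c v hv => by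
          rw [(𝒯.weakStrain_linear k (k - 1) T).2 c v hv, Matrix.smul_apply, polyEval_smul]⟩
    exact IsBilinOn.mul h h
  · refine IsBilinOn.setIntegral (fun u _ v _ =>
      𝒯.integrableOn_elem_mul T (hlam T) (by fun_prop)) fun z => IsBilinOn.const_mul ?_ _
    have h : IsLinearOn (𝒯.W k) fun v => polyEval (weakDiv 𝒯 (k - 1) T v) z :=
      ⟨fun u hu v hv => by
          rw [(𝒯.weakDiv_linear k (k - 1) T).1 u hu v hv, polyEval_add],
        fun c v hv => by
          rw [(𝒯.weakDiv_linear k (k - 1) T).2 c v hv, polyEval_smul]⟩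
    exact IsBilinOn.mul h h

theorem PolyMesh.isLinearOn_load (k : ℕ) {f : Pt d → Pt d} {ψ : Fin M → Pt d → Pt d}
    (hf : ∀ T, IntegrableOn f (𝒯.elem T))
    (hψ : ∀ m e, 𝒯.face e ⊆ G.Γ m → IntegrableOn (ψ m) (𝒯.face e) (surf d)) :
    IsLinearOn (𝒯.W k) (load 𝒯 f ψ) := by
  classical
  refine IsLinearOn.add (IsLinearOn.sum fun T _ => ?_) (IsLinearOn.sum fun m _ =>
    IsLinearOn.sum fun e _ => IsLinearOn.sum fun T _ => IsLinearOn.sum fun T' _ => ?_)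
  · refine IsLinearOn.setIntegral (fun v _ => integrableOn_inner (𝒯.isOpen_elem T).measurableSet
      (𝒯.isBounded_elem T).isCompact_closure subset_closure (hf T)
      (continuous_polyVec _).continuousOn) fun z => ⟨fun u _ v _ => ?_, fun c v _ => ?_⟩
    · rw [← inner_add_right, ← polyVec_add]; rfl
    · rw [← real_inner_smul_right, ← polyVec_smul]; rfl
  · by_cases h : 𝒯.IsInterfaceFace m e T T'
    · simp only [if_pos h]
      refine IsLinearOn.setIntegral (fun v hv => integrableOn_inner
        (𝒯.face_flat e).isCompact.measurableSet (𝒯.face_flat e).isCompact subset_rfl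
        (hψ m e h.1) (MemW.continuousOn hv h.2.1)) fun z => ⟨fun u _ v _ => ?_, fun c v _ => ?_⟩
      · rw [← inner_add_right]; rfl
      · rw [← real_inner_smul_right]; rfl
    · simp only [if_neg h]
      exact ⟨by simp, by simp⟩

variable {𝒯} in
-- Coercivity without constants: each nonnegative term is zero, so `v` is an exact rigid motion on
-- each element with matching traces, and these motions are removed by propagation from the
-- boundary. The weak divergence enters only through the sign of its term.
theorem MemW0.eq_zero [Nonempty (Fin d)] {k : ℕ} {mu lam : Pt d → ℝ}
    (hmu_pos : ∀ T, ∀ x ∈ 𝒯.elem T, 0 < mu x) (hlam_pos : ∀ T, ∀ x ∈ 𝒯.elem T, 0 < lam x)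
    (hmu : ∀ T, IntegrableOn mu (𝒯.elem T)) {v : WeakFn d ι κ} (hv : MemW0 𝒯 k v)
    (h : stab 𝒯 k v v + elasticForm 𝒯 k mu lam v v = 0) : v = 0 := by
  classical
  have hW := hv.memW
  have hs0 : ∀ T, ∀ e ∈ 𝒯.facesOf T, 0 ≤ ∫ x in 𝒯.face e,
      inner ℝ (bdryDefect 𝒯 k v T e x) (bdryDefect 𝒯 k v T e x) ∂(surf d) := fun T e _ =>
    integral_nonneg fun x => real_inner_self_nonneg
  have hs1 : ∀ T, 0 ≤ (Metric.diam (𝒯.elem T))⁻¹ * ∑ e ∈ 𝒯.facesOf T, ∫ x in 𝒯.face e,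
      inner ℝ (bdryDefect 𝒯 k v T e x) (bdryDefect 𝒯 k v T e x) ∂(surf d) := fun T =>
    mul_nonneg (inv_nonneg.2 Metric.diam_nonneg) (Finset.sum_nonneg (hs0 T))
  have ha0 : ∀ T, 0 ≤ ∫ x in 𝒯.elem T, 2 * mu x * ∑ i, ∑ j,
      polyEval (weakStrain 𝒯 (k - 1) T v i j) x * polyEval (weakStrain 𝒯 (k - 1) T v i j) x :=
    fun T => setIntegral_nonneg (𝒯.isOpen_elem T).measurableSet fun x hx =>
      mul_nonneg (mul_nonneg zero_le_two (hmu_pos T x hx).le)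
        (Finset.sum_nonneg fun i _ => Finset.sum_nonneg fun j _ => mul_self_nonneg _)
  have ha1 : ∀ T, 0 ≤ ∫ x in 𝒯.elem T, lam x *
      (polyEval (weakDiv 𝒯 (k - 1) T v) x * polyEval (weakDiv 𝒯 (k - 1) T v) x) :=
    fun T => setIntegral_nonneg (𝒯.isOpen_elem T).measurableSet fun x hx =>
      mul_nonneg (hlam_pos T x hx).le (mul_self_nonneg _)
  have hstab : stab 𝒯 k v v = 0 ∧ elasticForm 𝒯 k mu lam v v = 0 :=
    (add_eq_zero_iff_of_nonneg (Finset.sum_nonneg fun T _ => hs1 T)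
      (Finset.sum_nonneg fun T _ => add_nonneg (ha0 T) (ha1 T))).1 h
  have hb : ∀ T, ∀ e ∈ 𝒯.facesOf T, v.vb T e = faceProj k (𝒯.face e) (polyVec (v.v0 T)) := by
    intro T e he
    have h1 := (Finset.sum_eq_zero_iff_of_nonneg fun T _ => hs1 T).1 hstab.1 T (Finset.mem_univ T)
    have h2 := (mul_eq_zero.1 h1).resolve_left (inv_ne_zero (𝒯.diam_pos T).ne')
    have h3 := (Finset.sum_eq_zero_iff_of_nonneg (hs0 T)).1 h2 e he
    have h4 := (𝒯.face_flat e).faceInner_definite (PolyMesh.isUnitNormal he) _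
      (hW.bdryDefect_mem he) h3
    funext x
    exact (sub_eq_zero.1 (congrFun h4 x)).symm
  have hstrain : ∀ T, weakStrain 𝒯 (k - 1) T v = 0 := by
    intro T
    have h1 := (Finset.sum_eq_zero_iff_of_nonneg fun T _ => add_nonneg (ha0 T) (ha1 T)).1
      hstab.2 T (Finset.mem_univ T)
    have h2 := ((add_eq_zero_iff_of_nonneg (ha0 T) (ha1 T)).1 h1).1
    exact 𝒯.weighted_strainInner_definite T (w := fun x => 2 * mu x)
      (fun x hx => mul_pos two_pos (hmu_pos T x hx)) ((hmu T).const_mul 2) h2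
  choose a η hη hrig using fun T =>
    exists_rigidMotion fun i j => hW.symmGrad_eq_zero T (hb T) (hstrain T) i j
  have hvb : ∀ T, ∀ e ∈ 𝒯.facesOf T,
      v.vb T e = (𝒯.face e).indicator (rigidMotion (a T) (η T)) := by
    intro T e he
    rw [hb T e he]
    refine (𝒯.face_flat e).faceProj_eq_of_mem (PolyMesh.isUnitNormal he)
      ⟨0, a T, η T, by simp, hη T, ?_⟩ fun x hx => ?_
    · congr 1
      funext x
      rw [polyVec_zero, zero_add]
    · rw [indicator_of_mem hx, hrig]
  have hzero : ∀ T, ∀ e ∈ 𝒯.facesOf T, v.vb T e = 0 → v.v0 T = 0 := by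
    intro T e he h0
    have h1 := (𝒯.face_flat e).rigidMotion_eq_zero (PolyMesh.isUnitNormal he) (hη T)
      (a := a T) fun x hx => by
        rw [← indicator_of_mem hx (rigidMotion (a T) (η T)), ← hvb T e he, h0]; rfl
    funext i
    refine eq_zero_of_polyEval_eq_zero (𝒯.isOpen_elem T) (𝒯.nonempty_elem T) fun x _ => ?_
    rw [← polyVec_apply, hrig, h1]; rfl
  have hvb0 : ∀ T, ∀ e ∈ 𝒯.facesOf T, v.v0 T = 0 → v.vb T e = 0 := by
    intro T e he h0
    rw [hvb T e he]
    funext x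
    by_cases hx : x ∈ 𝒯.face e
    · rw [indicator_of_mem hx, ← hrig, h0, polyVec_zero]; rfl
    · exact indicator_of_notMem hx _
  -- A boundary face, or a neighbour with zero interior value, forces a zero trace on a face and
  -- hence a zero rigid motion. The nonzero elements therefore satisfy the hypotheses of
  -- `PolyMesh.eq_empty_of_closed`.
  have hA : (Finset.univ.filter fun T => v.v0 T ≠ 0) = ∅ := by
    refine 𝒯.eq_empty_of_closed (fun T hT e he hbd => ?_) fun T hT e he T' he' => ?_
    · exact (Finset.mem_filter.1 hT).2 (hzero T e he (hv.boundary T e he hbd))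
    · refine Finset.mem_filter.2 ⟨Finset.mem_univ _, fun h0 => (Finset.mem_filter.1 hT).2 ?_⟩
      refine hzero T e he ?_
      rw [hv.single_valued_all e T T' he he', hvb0 T' e he' h0]
  have hv0 : ∀ T, v.v0 T = 0 := by
    intro T
    by_contra hT
    have : T ∈ (Finset.univ.filter fun T => v.v0 T ≠ 0) := by simp [hT]
    rw [hA] at this
    exact absurd this (Finset.notMem_empty T)
  refine WeakFn.ext (funext hv0) ?_
  funext T e
  by_cases he : e ∈ 𝒯.facesOf T
  · exact hvb0 T e he (hv0 T)
  · exact hW.eq_zero T e he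

end WG
end

/-! ### Existence and uniqueness for the scheme. -/

theorem mainTheorem1 {d N M : ℕ} (hd : d = 2 ∨ d = 3) (G : WG.InterfaceGeometry d N M)
    {ι κ : Type*} [Fintype ι] [Fintype κ] (𝒯 : WG.PolyMesh G ι κ) (k : ℕ) (hk : 1 ≤ k)
    (mu lam : WG.Pt d → ℝ)
    (hmu_pos : ∀ i, ∀ x ∈ G.sub i, 0 < mu x) (hlam_pos : ∀ i, ∀ x ∈ G.sub i, 0 < lam x)
    (hmu_int : ∀ i, MeasureTheory.IntegrableOn mu (G.sub i))
    (hlam_int : ∀ i, MeasureTheory.IntegrableOn lam (G.sub i))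
    (f g : WG.Pt d → WG.Pt d) (φ ψ : Fin M → WG.Pt d → WG.Pt d)
    (hf : ∀ i, MeasureTheory.MemLp f 2 (MeasureTheory.volume.restrict (G.sub i)))
    (hg : MeasureTheory.MemLp g 2 ((WG.surf d).restrict (frontier G.Ω)))
    (hφ : ∀ m, MeasureTheory.MemLp (φ m) 2 ((WG.surf d).restrict (G.Γ m)))
    (hψ : ∀ m, MeasureTheory.MemLp (ψ m) 2 ((WG.surf d).restrict (G.Γ m))) :
    ∃! u : WG.WeakFn d ι κ, WG.IsSolution 𝒯 k mu lam f g φ ψ u := by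
  have : Nonempty (Fin d) := ⟨⟨0, by omega⟩⟩
  have hmu : ∀ T, IntegrableOn mu (𝒯.elem T) := fun T =>
    (𝒯.elem_aligned T).elim fun i hi => (hmu_int i).mono_set hi
  have hlam : ∀ T, IntegrableOn lam (𝒯.elem T) := fun T =>
    (𝒯.elem_aligned T).elim fun i hi => (hlam_int i).mono_set hi
  have hmu_pos' : ∀ T, ∀ x ∈ 𝒯.elem T, 0 < mu x := fun T x hx =>
    (𝒯.elem_aligned T).elim fun i hi => hmu_pos i x (hi hx)
  have hlam_pos' : ∀ T, ∀ x ∈ 𝒯.elem T, 0 < lam x := fun T x hx =>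
    (𝒯.elem_aligned T).elim fun i hi => hlam_pos i x (hi hx)
  have hf' : ∀ T, IntegrableOn f (𝒯.elem T) := fun T =>
    (𝒯.elem_aligned T).elim fun i hi =>
      WG.integrableOn_of_memLp_two hi (𝒯.isBounded_elem T).measure_lt_top (hf i)
  have hB := (𝒯.isBilinOn_stab k).add (𝒯.isBilinOn_elasticForm k hmu hlam)
  have hB0 := hB.mono (𝒯.W0_le_W k) (𝒯.W0_le_W k)
  have hdef : ∀ v ∈ 𝒯.W0 k, WG.stab 𝒯 k v v + WG.elasticForm 𝒯 k mu lam v v = 0 → v = 0 :=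
    fun _ hv h => WG.MemW0.eq_zero hmu_pos' hlam_pos' hmu hv h
  have hload := 𝒯.isLinearOn_load k (ψ := ψ) hf' fun m e he =>
    𝒯.integrableOn_face_of_memLp he (hψ m)
  have hlift : 𝒯.lift k g φ ∈ 𝒯.W k :=
    𝒯.lift_memW (fun e he => 𝒯.integrableOn_face_of_memLp he hg) fun m e he =>
      𝒯.integrableOn_face_of_memLp he (hφ m)
  -- The correction `w` solves the homogeneous-constraint problem whose right-hand side is the load
  -- minus the form applied to the lift.
  obtain ⟨w, hw, hweq⟩ := hB0.exists_of_definite hdef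
    ((hload.add ((hB.2 _ hlift).const_mul (-1))).mono (𝒯.W0_le_W k))
  refine ⟨𝒯.lift k g φ + w, ⟨(𝒯.W k).add_mem hlift hw.memW, ?_, ?_, ?_⟩, fun u hu => ?_⟩
  · intro T e he hb
    simp [𝒯.lift_boundary he hb, hw.boundary T e he hb]
  · intro m e T T' h
    rw [← h.lift_jump (k := k) (g := g)]
    simp [hw.single_valued_all e T T' h.2.1 h.2.2.1]
  · intro v hv
    rw [(hB.1 v hv.memW).map_add _ hlift _ hw.memW, hweq v hv]
    ring
  · have hsol : ∀ v, WG.MemW0 𝒯 k v → WG.stab 𝒯 k (𝒯.lift k g φ + w) v +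
        WG.elasticForm 𝒯 k mu lam (𝒯.lift k g φ + w) v = WG.load 𝒯 f ψ v := by
      intro v hv
      rw [(hB.1 v hv.memW).map_add _ hlift _ hw.memW, hweq v hv]
      ring
    have hmem := (𝒯.W k).add_mem hlift hw.memW
    -- The two solutions carry the same boundary values and jumps, so their difference is itself an
    -- admissible test function.
    have hsub : u - (𝒯.lift k g φ + w) ∈ 𝒯.W0 k := by
      refine 𝒯.sub_memW0 (g := g) (φ := φ) hu.memW hmem hu.boundary (fun T e he hb => ?_) hu.jump
        fun m e T T' h => ?_
      · simp [𝒯.lift_boundary he hb, hw.boundary T e he hb]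
      · rw [← h.lift_jump (k := k) (g := g)]
        simp [hw.single_valued_all e T T' h.2.1 h.2.2.1]
    refine sub_eq_zero.1 (hdef _ hsub ?_)
    rw [(hB.1 _ (𝒯.W0_le_W k hsub)).map_sub hu.memW hmem, hu.equation _ hsub, hsol _ hsub, sub_self]
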